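/- **Conventions.** For a group $G$ with a finite generating set $S$, let $B_S(t)$ be the ball of radius $t$ around the identity for the word distance of $S$. A finitely generated group $G$ has *exponential growth* if $\lim_{t\to\infty}\frac1t\log|B_S(t)|\neq 0$ for some (equivalently, any) finite generating set $S$. A group has *subexponential growth* if it is finitely generated and does not have exponential growth; its *subexponential growth rate* is then $\limsup_{t\to\infty}\frac{\log\log|B_S(t)|}{\log t}$, which does not depend on $S$ (it is taken to be $0$ for the trivial group). Maps and covers live on the polyhedron underlying a simplicial complex, and a simplicial map from $X$ to $P$ is allowed to be simplicial with respect to some finite subdivision of $X$. Let $X$ be a connected finite simplicial complex of dimension $m$ and let $0\le k<m$ be an integer. *Collapsing assumption.* $X$ satisfies the collapsing assumption onto a simplicial $k$-complex if, after a finite subdivision of $X$, there is a simplicial map $\pi:X\to P$ onto a simplicial complex $P$ of dimension at most $k$ such that, for every $p\in P$ and every connected component $F_p$ of the fiber $\pi^{-1}(p)$, the subgroup $i_*[\pi_1(F_p)]$ of $\pi_1(X)$ has subexponential growth, where $i:F_p\hookrightarrow X$ is the inclusion. It does so with subexponential growth rate at most $\nu$ if moreover all these subgroups have subexponential growth rate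 at most $\nu$. *$\pi_1$-growth of open subsets.* A path-connected open subset $U\subseteq X$ has subexponential $\pi_1$-growth in $X$ (with rate at most $\nu$) if the subgroup $i_*[\pi_1(U)]$ of $\pi_1(X)$ has subexponential growth (with rate at most $\nu$), where $i:U\hookrightarrow X$ is the inclusion. **Proposition.** $X$ satisfies the collapsing assumption onto a simplicial $k$-complex if and only if $X$ has a cover of multiplicity at most $k+1$ (every point lies in at most $k+1$ members) by path-connected open subsets of subexponential $\pi_1$-growth in $X$. Likewise, for every real number $\nu$, $X$ satisfies the collapsing assumption with subexponential growth rate at most $\nu$ onto a simplicial $k$-complex if and only if $X$ has a cover of multiplicity at most $k+1$ by path-connected open subsets of subexponential $\pi_1$-growth in $X$ with rate at most $\nu$. -/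

import Mathlib

open Filter

noncomputable section

/-! ### Growth of finitely generated groups -/

/-- The ball `B_S(n)` of radius `n` around the identity for the word metric of `S`: the products of
at most `n` elements of `S ∪ S⁻¹`. -/
def wordBall {G : Type*} [Group G] (S : Finset G) (n : ℕ) : Set G :=
  {g | ∃ l : List G, l.length ≤ n ∧ (∀ a ∈ l, a ∈ S ∨ a⁻¹ ∈ S) ∧ l.prod = g}

/-- The finite set `S` generates the group `G`. -/
def Generates {G : Type*} [Group G] (S : Finset G) : Prop :=
  Subgroup.closure (S : Set G) = ⊤

/-- `ent(G, S) = lim_{n → ∞} log |B_S(n)| / n`. (The limit exists by subadditivity, so it is the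
upper limit.) -/
def wordEntropy {G : Type*} [Group G] (S : Finset G) : EReal :=
  limsup (fun n : ℕ => ((Real.log ((wordBall S n).ncard : ℝ) / (n : ℝ) : ℝ) : EReal)) atTop

/-- A finitely generated group has exponential growth if `ent(G, S) ≠ 0` for some finite
generating set `S`. -/
def HasExponentialGrowth (G : Type*) [Group G] : Prop :=
  ∃ S : Finset G, Generates S ∧ wordEntropy S ≠ 0

/-- Subexponential growth: finitely generated, and not of exponential growth. -/
def HasSubexponentialGrowth (G : Type*) [Group G] : Prop :=
  Group.FG G ∧ ¬ HasExponentialGrowth G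

/-- `limsup_{n → ∞} log log |B_S(n)| / log n`. For the trivial group the convention `log 0 = 0` of
`Real.log` gives the rate `0`, as for every other finite group. -/
def subexpRate {G : Type*} [Group G] (S : Finset G) : EReal :=
  limsup (fun n : ℕ =>
    ((Real.log (Real.log ((wordBall S n).ncard : ℝ)) / Real.log (n : ℝ) : ℝ) : EReal)) atTop

/-- `G` has subexponential growth, with subexponential growth rate at most `ν`. (The rate does not
depend on the finite generating set.) -/
def HasSubexponentialGrowthRateLE (ν : ℝ) (G : Type*) [Group G] : Prop :=
  HasSubexponentialGrowth G ∧ ∀ S : Finset G, Generates S → subexpRate S ≤ (ν : EReal)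

/-! ### Images of fundamental groups of subspaces -/

/-- For a subspace `A` of `X` and a base point `x ∈ A`, the subgroup `i_*[π₁(A, x)]` of `π₁(X, x)`,
where `i : A → X` is the inclusion. -/
def pi1Image {X : Type*} [TopologicalSpace X] (A : Set X) (x : A) :
    Subgroup (FundamentalGroup X (x : X)) :=
  (FundamentalGroup.map (⟨Subtype.val, continuous_subtype_val⟩ : C(A, X)) x).range

/-! ### Simplicial complexes, subdivisions, simplicial maps -/

universe u

/-- Every simplex of `K` has dimension at most `n`. -/
def DimAtMost {E : Type*} [AddCommGroup E] [Module ℝ E]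
    (K : Geometry.SimplicialComplex ℝ E) (n : ℕ) : Prop :=
  ∀ s ∈ K.faces, s.card ≤ n + 1

/-- `K` has dimension exactly `n`. -/
def DimEq {E : Type*} [AddCommGroup E] [Module ℝ E]
    (K : Geometry.SimplicialComplex ℝ E) (n : ℕ) : Prop :=
  DimAtMost K n ∧ ∃ s ∈ K.faces, s.card = n + 1

/-- `K'` is a (finite) subdivision of the finite simplicial complex `K`. -/
structure IsFiniteSubdivision {E : Type*} [AddCommGroup E] [Module ℝ E]
    (K' K : Geometry.SimplicialComplex ℝ E) : Prop where
  finite : K'.faces.Finite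
  space_eq : K'.space = K.space
  subset_face : ∀ s ∈ K'.faces, ∃ t ∈ K.faces,
    convexHull ℝ (s : Set E) ⊆ convexHull ℝ (t : Set E)

/-- `f` restricts to a simplicial map from `K` to `L`: it sends the vertices of every simplex of `K`
onto the vertices of a simplex of `L`, and is affine in barycentric coordinates on each simplex.
Only the values of `f` on the underlying space of `K` matter. -/
def IsSimplicialMap {E F : Type*} [AddCommGroup E] [Module ℝ E] [AddCommGroup F] [Module ℝ F]
    (K : Geometry.SimplicialComplex ℝ E) (L : Geometry.SimplicialComplex ℝ F) (f : E → F) : Prop :=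
  ∀ s ∈ K.faces,
    (∃ t ∈ L.faces, (t : Set F) = f '' (s : Set E)) ∧
    ∀ w : E → ℝ, (∀ v ∈ s, 0 ≤ w v) → ∑ v ∈ s, w v = 1 →
      f (∑ v ∈ s, w v • v) = ∑ v ∈ s, w v • f v

/-! ### The two conditions -/

/-- For the polyhedron `X` underlying the complex `K` and a property `Q` of groups: after a finite
subdivision of `K`, there is a simplicial map `π` onto a simplicial complex `P` of dimension at most
`k` such that, for every connected component `F` of every fiber `π⁻¹(p)`, `p ∈ P`, the subgroup
`i_*[π₁(F)]` of `π₁(X)` has property `Q`. The components of the fiber are enumerated by their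
points `x`, which serve as base points. (As `π` is onto, `P` is a finite complex, so it may be
taken in some Euclidean space.) -/
def FiberCollapsing {E : Type u} [NormedAddCommGroup E] [NormedSpace ℝ E]
    (K : Geometry.SimplicialComplex ℝ E) (k : ℕ) (Q : ∀ (G : Type u) [Group G], Prop) : Prop :=
  ∃ (K' : Geometry.SimplicialComplex ℝ E) (N : ℕ)
    (P : Geometry.SimplicialComplex ℝ (EuclideanSpace ℝ (Fin N)))
    (π : E → EuclideanSpace ℝ (Fin N)),
    IsFiniteSubdivision K' K ∧ DimAtMost P k ∧ IsSimplicialMap K' P π ∧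
    π '' K.space = P.space ∧
    ∀ p ∈ P.space, ∀ (x : K.space) (hx : π x = p),
      Q (pi1Image (connectedComponentIn {y : K.space | π y = p} x)
        ⟨x, mem_connectedComponentIn hx⟩)

/-- The space `X` has a cover by path-connected open subsets `U`, of multiplicity at most `k + 1`
(every point lies in at most `k + 1` of them), such that the subgroup `i_*[π₁(U)]` of `π₁(X)` has
property `Q` for each `U` in the cover. -/
def HasOpenCoverOfMultiplicity (X : Type u) [TopologicalSpace X] (k : ℕ)
    (Q : ∀ (G : Type u) [Group G], Prop) : Prop :=
  ∃ 𝒰 : Set (Set X),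
    ⋃₀ 𝒰 = Set.univ ∧
    (∀ x : X, {U ∈ 𝒰 | x ∈ U}.encard ≤ k + 1) ∧
    ∀ U ∈ 𝒰, IsOpen U ∧ IsPathConnected U ∧ ∀ x : U, Q (pi1Image U x)

end

/-! From a cover to a collapse. Let δ be a Lebesgue number of the cover and subdivide until edges
have length at most δ/2. Choose for each vertex v a member U_v of the cover that contains the δ-ball
around v; it then contains the open star of v. Sending v to the basis vector indexed by U_v and
extending linearly on simplices gives a simplicial map. The barycenter of a simplex lies in U_v for
each vertex v of it, so at most k+1 different vertices occur in its image. If v carries weight at x,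
then every point of the fiber through x carries weight at some u with U_u = U_v, so the whole fiber
lies in U_v. Hence the group of a fiber component F is, up to isomorphism, a subgroup of the group
of U_v. It is finitely generated because F is a finite union of compact convex sets, and growth
bounds pass to finitely generated subgroups.

From a collapse to a cover. The preimage of the open star of a vertex v of P deforms onto the fiber
over v: the barycentric weight is pushed towards the vertices that lie over v. The cover consists of
the sets of points that end in a given component of such a fiber. A point x lies in exactly one of
these sets for each vertex of the simplex carrying π(x), so in at most k+1, and the deformation
identifies the image of π₁ with that of the fiber component.

The two implications are `fiberCollapsing_of_hasOpenCover` and `hasOpenCover_of_fiberCollapsing`,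
for a property `Q` that passes to finitely generated subgroups, respectively is invariant under
isomorphism. The carrying lemmas are `HasSubexponentialGrowth.of_injective` and its version with
rates, `exists_subdivision_dist_le` (fine subdivisions), `pi1Image_fiber_fg` (finite generation) and
`exists_deformation_openStarPreimage`. Points of a polyhedron are handled throughout by their
barycentric weights, as finitely supported functions on the ambient space. -/

noncomputable section

open Geometry CategoryTheory Topology unitInterval

/-! ### Growth of finitely generated subgroups -/

section Growth

variable {G H : Type*} [Group G] [Group H]

theorem one_mem_wordBall (S : Finset G) (n : ℕ) : (1 : G) ∈ wordBall S n :=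
  ⟨[], by simp, by simp, by simp⟩

theorem wordBall_finite (S : Finset G) (n : ℕ) : (wordBall S n).Finite := by
  classical
  have hA : Finite {a : G // a ∈ S ∪ S.image (·⁻¹)} := inferInstance
  have := (List.finite_length_le {a : G // a ∈ S ∪ S.image (·⁻¹)} n).image
    (fun l => (l.map Subtype.val).prod)
  refine this.subset ?_
  rintro g ⟨l, hl, hmem, rfl⟩
  refine ⟨l.attach.map (fun a => ⟨a.1, ?_⟩), by simpa using hl, ?_⟩
  · rcases hmem _ a.2 with h | h
    · exact Finset.mem_union_left _ h
    · exact Finset.mem_union_right _ (Finset.mem_image.2 ⟨_, h, by simp⟩)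
  · simp [Function.comp_def]

theorem wordBall_ncard_pos (S : Finset G) (n : ℕ) : 0 < (wordBall S n).ncard :=
  (Set.ncard_pos (wordBall_finite S n)).2 ⟨1, one_mem_wordBall S n⟩

theorem wordBall_inv_mem {S : Finset G} {n : ℕ} {g : G} (hg : g ∈ wordBall S n) :
    g⁻¹ ∈ wordBall S n := by
  obtain ⟨l, hl, hmem, rfl⟩ := hg
  refine ⟨(l.map (·⁻¹)).reverse, by simpa using hl, ?_, by rw [List.prod_inv_reverse]⟩
  intro a ha
  simp only [List.mem_reverse, List.mem_map] at ha
  obtain ⟨b, hb, rfl⟩ := ha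
  rcases hmem b hb with h | h
  · right; simpa using h
  · left; exact h

theorem wordBall_mono (S : Finset G) {m n : ℕ} (h : m ≤ n) : wordBall S m ⊆ wordBall S n := by
  rintro g ⟨l, hl, hmem, rfl⟩
  exact ⟨l, hl.trans h, hmem, rfl⟩

theorem wordBall_mul_mem {S : Finset G} {m n : ℕ} {g h : G} (hg : g ∈ wordBall S m)
    (hh : h ∈ wordBall S n) : g * h ∈ wordBall S (m + n) := by
  obtain ⟨l, hl, hmem, rfl⟩ := hg
  obtain ⟨l', hl', hmem', rfl⟩ := hh
  refine ⟨l ++ l', by simp; omega, ?_, by simp⟩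
  intro a ha
  rcases List.mem_append.1 ha with h | h
  exacts [hmem a h, hmem' a h]

theorem exists_mem_wordBall {S : Finset G} (hS : Generates S) (g : G) :
    ∃ n, g ∈ wordBall S n := by
  have hg : g ∈ Subgroup.closure (S : Set G) := by rw [hS]; trivial
  induction hg using Subgroup.closure_induction with
  | mem x hx => exact ⟨1, [x], by simp, by simpa using Or.inl hx, by simp⟩
  | one => exact ⟨0, one_mem_wordBall S 0⟩
  | mul x y _ _ hx hy =>
    obtain ⟨m, hm⟩ := hx
    obtain ⟨n, hn⟩ := hy
    exact ⟨m + n, wordBall_mul_mem hm hn⟩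
  | inv x _ hx =>
    obtain ⟨m, hm⟩ := hx
    exact ⟨m, wordBall_inv_mem hm⟩

/-- The images of the finitely many elements of `T` have bounded `S`-length, so an injective
homomorphism stretches word length at most by a constant factor. -/
theorem exists_ncard_wordBall_le {S : Finset G} (hS : Generates S) (f : H →* G)
    (hf : Function.Injective f) (T : Finset H) :
    ∃ c : ℕ, 0 < c ∧ ∀ n, (wordBall T n).ncard ≤ (wordBall S (c * n)).ncard := by
  classical
  choose N hN using fun t : H => exists_mem_wordBall hS (f t)
  -- The summand 1 keeps `c` positive even if `T` is empty or all lengths vanish.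
  set c := T.sup N + 1 with hc
  have key : ∀ l : List H, (∀ a ∈ l, a ∈ T ∨ a⁻¹ ∈ T) →
      f l.prod ∈ wordBall S (c * l.length) := by
    intro l
    induction l with
    | nil => intro _; simpa using one_mem_wordBall S 0
    | cons a l ih =>
      intro h
      have ha : f a ∈ wordBall S c := by
        rcases h a (by simp) with h | h
        · exact wordBall_mono S ((Finset.le_sup h).trans (Nat.le_succ _)) (hN a)
        · have := wordBall_inv_mem
            (wordBall_mono S ((Finset.le_sup h).trans (Nat.le_succ _)) (hN a⁻¹))
          simpa using this
      have := wordBall_mul_mem ha (ih fun b hb => h b (by simp [hb]))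
      rw [List.prod_cons, map_mul, List.length_cons, mul_add, mul_one, add_comm]
      exact this
  refine ⟨c, Nat.succ_pos _, fun n => ?_⟩
  rw [← Set.ncard_image_of_injective _ hf]
  refine Set.ncard_le_ncard ?_ (wordBall_finite _ _)
  rintro _ ⟨_, ⟨l, hl, hmem, rfl⟩, rfl⟩
  exact wordBall_mono S (Nat.mul_le_mul_left c hl) (key l hmem)

theorem log_ncard_wordBall_nonneg (S : Finset G) (n : ℕ) :
    0 ≤ Real.log ((wordBall S n).ncard : ℝ) :=
  Real.log_nonneg (by exact_mod_cast wordBall_ncard_pos S n)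

theorem wordEntropy_nonneg (S : Finset G) : 0 ≤ wordEntropy S := by
  refine le_limsup_of_frequently_le (Frequently.of_forall fun n => ?_)
  exact_mod_cast div_nonneg (log_ncard_wordBall_nonneg S n) (Nat.cast_nonneg n)

/-- Rescaling the radius by `c` multiplies the entropy bound by `c`, which does not matter when the
entropy of `G` is 0: a bound ε/c for `G` becomes a bound ε for `H`. -/
theorem HasSubexponentialGrowth.of_injective (hG : HasSubexponentialGrowth G) (f : H →* G)
    (hf : Function.Injective f) (hH : Group.FG H) : HasSubexponentialGrowth H := by
  refine ⟨hH, ?_⟩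
  rintro ⟨T, -, hT⟩
  obtain ⟨S, hS⟩ := hG.1.out
  have hS0 : wordEntropy S = 0 := by
    by_contra h
    exact hG.2 ⟨S, hS, h⟩
  obtain ⟨c, hc, hle⟩ := exists_ncard_wordBall_le hS f hf T
  refine hT (le_antisymm ?_ (wordEntropy_nonneg T))
  refine EReal.le_of_forall_lt_iff_le.1 fun ε hε => ?_
  have hε' : 0 < ε := by exact_mod_cast hε
  have hc' : (0 : ℝ) < c := by exact_mod_cast hc
  have hlt : wordEntropy S < ((ε / c : ℝ) : EReal) := by
    rw [hS0]; exact_mod_cast div_pos hε' hc'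
  have hev := eventually_lt_of_limsup_lt hlt
  have hev' := (tendsto_id.const_mul_atTop' hc).eventually hev
  refine limsup_le_of_le (by isBoundedDefault) ?_
  filter_upwards [hev', eventually_gt_atTop 0] with n hn hn0
  have hn' : (0 : ℝ) < n := by exact_mod_cast hn0
  simp only [id, EReal.coe_lt_coe_iff, Nat.cast_mul] at hn
  rw [EReal.coe_le_coe_iff, div_le_iff₀ hn']
  rw [div_lt_iff₀ (by positivity)] at hn
  calc Real.log ((wordBall T n).ncard : ℝ) ≤ Real.log ((wordBall S (c * n)).ncard : ℝ) :=
        Real.log_le_log (by exact_mod_cast wordBall_ncard_pos T n) (by exact_mod_cast hle n)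
    _ ≤ ε / c * (c * n) := hn.le
    _ = ε * n := by field_simp

/-- For negative `a` the quantity `a * log n` tends to -∞, whereas log log |B(n)| is at least log
log 2, or is 0 by convention when the ball is trivial. -/
theorem nonneg_of_subexpRate_lt {S : Finset G} {a : ℝ} (h : subexpRate S < (a : EReal)) :
    0 ≤ a := by
  have hev := eventually_lt_of_limsup_lt h
  by_contra! ha
  have hlog : Tendsto (fun n : ℕ => a * Real.log (n : ℝ)) atTop atBot :=
    (Real.tendsto_log_atTop.comp tendsto_natCast_atTop_atTop).const_mul_atTop_of_neg ha
  obtain ⟨n, hn, hn1, hn2, hn3⟩ := (hev.and ((hlog.eventually_lt_atBot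
    (Real.log (Real.log 2))).and ((hlog.eventually_lt_atBot 0).and
      (eventually_gt_atTop 1)))).exists
  have hn' : 0 < Real.log (n : ℝ) := Real.log_pos (by exact_mod_cast hn3)
  rw [EReal.coe_lt_coe_iff, div_lt_iff₀ hn'] at hn
  have hpos := wordBall_ncard_pos S n
  rcases Nat.lt_or_ge (wordBall S n).ncard 2 with h2 | h2
  · have : (wordBall S n).ncard = 1 := by omega
    rw [this] at hn
    simp at hn
    linarith
  · have : Real.log (Real.log 2) ≤ Real.log (Real.log ((wordBall S n).ncard : ℝ)) := by
      refine Real.log_le_log (Real.log_pos (by norm_num)) (Real.log_le_log (by norm_num) ?_)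
      exact_mod_cast h2
    linarith

/-- In log log |B(cn)| ≤ a (log c + log n) the term a log c is absorbed by (b - a) log n for any b >
a. Balls with one element are separate, since the logarithm is monotone only on positive arguments;
there the left side is 0 and b > a ≥ 0 suffices. -/
theorem HasSubexponentialGrowthRateLE.of_injective {ν : ℝ}
    (hG : HasSubexponentialGrowthRateLE ν G) (f : H →* G)
    (hf : Function.Injective f) (hH : Group.FG H) : HasSubexponentialGrowthRateLE ν H := by
  refine ⟨hG.1.of_injective f hf hH, fun T _ => ?_⟩
  obtain ⟨S, hS⟩ := hG.1.1.out
  have hSν := hG.2 S hS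
  obtain ⟨c, hc, hle⟩ := exists_ncard_wordBall_le hS f hf T
  refine EReal.le_of_forall_lt_iff_le.1 fun b hb => ?_
  obtain ⟨a, ha, hab⟩ := exists_between (EReal.coe_lt_coe_iff.1 hb)
  have hlt : subexpRate S < (a : EReal) := hSν.trans_lt (by exact_mod_cast ha)
  have ha0 : 0 ≤ a := nonneg_of_subexpRate_lt hlt
  have hev := eventually_lt_of_limsup_lt hlt
  have hev' := (tendsto_id.const_mul_atTop' hc).eventually hev
  have hlog : Tendsto (fun n : ℕ => (b - a) * Real.log (n : ℝ)) atTop atTop :=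
    (Real.tendsto_log_atTop.comp tendsto_natCast_atTop_atTop).const_mul_atTop (by linarith)
  refine limsup_le_of_le (by isBoundedDefault) ?_
  filter_upwards [hev', eventually_gt_atTop 1, hlog.eventually_ge_atTop (a * Real.log c)]
    with n hn hn1 hn2
  have hn' : 0 < Real.log (n : ℝ) := Real.log_pos (by exact_mod_cast hn1)
  have hc1 : (0 : ℝ) ≤ Real.log c := Real.log_nonneg (by exact_mod_cast hc)
  have hlogc : Real.log ((c : ℝ) * n) = Real.log c + Real.log n :=
    Real.log_mul (by exact_mod_cast hc.ne') (by positivity)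
  rw [EReal.coe_le_coe_iff, div_le_iff₀ hn']
  simp only [id, EReal.coe_lt_coe_iff, Nat.cast_mul, hlogc] at hn
  rw [div_lt_iff₀ (by positivity)] at hn
  have hpos := wordBall_ncard_pos T n
  rcases Nat.lt_or_ge (wordBall T n).ncard 2 with h2 | h2
  · have : (wordBall T n).ncard = 1 := by omega
    rw [this]
    simp only [Nat.cast_one, Real.log_one, Real.log_zero]
    exact mul_nonneg (by linarith) hn'.le
  · have : Real.log (Real.log ((wordBall T n).ncard : ℝ)) ≤
        Real.log (Real.log ((wordBall S (c * n)).ncard : ℝ)) := by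
      refine Real.log_le_log (Real.log_pos (by exact_mod_cast h2)) (Real.log_le_log ?_ ?_)
      · exact_mod_cast hpos
      · exact_mod_cast hle n
    linarith

end Growth

/-! ### Barycentric weights -/

section Weights

variable {E : Type*}

/-- The total mass of the weights `w`. -/
def totalMass : (E →₀ ℝ) →ₗ[ℝ] ℝ := Finsupp.linearCombination ℝ fun _ => 1

theorem totalMass_single (v : E) (a : ℝ) : totalMass (Finsupp.single v a) = a := by
  simp [totalMass]

theorem totalMass_eq_sum {w : E →₀ ℝ} {s : Finset E} (h : w.support ⊆ s) :
    totalMass w = ∑ v ∈ s, w v := by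
  rw [totalMass, Finsupp.linearCombination_apply, Finsupp.sum_of_support_subset _ h _ (by simp)]
  simp

/-- Barycentric weights carried by a member of the family `𝓕` of simplices. -/
structure IsBary (𝓕 : Set (Finset E)) (w : E →₀ ℝ) : Prop where
  nonneg : ∀ v, 0 ≤ w v
  support_mem : w.support ∈ 𝓕
  mass : totalMass w = 1

theorem IsBary.support_nonempty {𝓕 : Set (Finset E)} {w : E →₀ ℝ} (h : IsBary 𝓕 w) :
    w.support.Nonempty := by
  rw [Finsupp.support_nonempty_iff]
  rintro rfl
  simpa using h.mass

theorem IsBary.pos_iff {𝓕 : Set (Finset E)} {w : E →₀ ℝ} (h : IsBary 𝓕 w) {v : E} :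
    0 < w v ↔ v ∈ w.support := by
  rw [Finsupp.mem_support_iff]
  exact ⟨ne_of_gt, fun h' => lt_of_le_of_ne (h.nonneg v) h'.symm⟩

end Weights

section Barycentric

variable {E : Type*} [AddCommGroup E] [Module ℝ E]

/-- The point with weights `w`. -/
def weightedPoint : (E →₀ ℝ) →ₗ[ℝ] E := Finsupp.linearCombination ℝ id

theorem weightedPoint_single (v : E) (a : ℝ) :
    weightedPoint (Finsupp.single v a) = a • v := by
  simp [weightedPoint]

theorem weightedPoint_eq_sum {w : E →₀ ℝ} {s : Finset E} (h : w.support ⊆ s) :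
    weightedPoint w = ∑ v ∈ s, w v • v := by
  rw [weightedPoint, Finsupp.linearCombination_apply, Finsupp.sum_of_support_subset _ h _ (by simp)]
  rfl

theorem weightedPoint_mem_convexHull {w : E →₀ ℝ} {s : Set E} (h0 : ∀ v, 0 ≤ w v)
    (hs : ↑w.support ⊆ s) (h1 : totalMass w = 1) : weightedPoint w ∈ convexHull ℝ s := by
  rw [weightedPoint_eq_sum subset_rfl]
  refine (convex_convexHull ℝ s).sum_mem (fun v _ => h0 v) ?_ ?_
  · rw [← totalMass_eq_sum subset_rfl, h1]
  · exact fun v hv => subset_convexHull ℝ s (hs hv)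

theorem exists_weights_of_mem_convexHull {s : Finset E} {x : E}
    (hx : x ∈ convexHull ℝ (s : Set E)) :
    ∃ w : E →₀ ℝ, (∀ v, 0 ≤ w v) ∧ w.support ⊆ s ∧ totalMass w = 1 ∧ weightedPoint w = x := by
  classical
  obtain ⟨w, h0, h1, h2⟩ := Finset.mem_convexHull'.1 hx
  refine ⟨Finsupp.onFinset s (fun v => if v ∈ s then w v else 0) (by simp +contextual), ?_,
    Finsupp.support_onFinset_subset, ?_, ?_⟩
  · intro v
    simp only [Finsupp.onFinset_apply]
    split_ifs with h
    exacts [h0 v h, le_rfl]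
  · rw [totalMass_eq_sum Finsupp.support_onFinset_subset, ← h1]
    exact Finset.sum_congr rfl fun v hv => by simp [hv]
  · rw [weightedPoint_eq_sum Finsupp.support_onFinset_subset, ← h2]
    exact Finset.sum_congr rfl fun v hv => by simp [hv]

theorem eq_of_affineIndependent {s : Finset E} (hs : AffineIndependent ℝ ((↑) : s → E))
    {w w' : E →₀ ℝ} (hw : w.support ⊆ s) (hw' : w'.support ⊆ s) (h1 : totalMass w = totalMass w')
    (h2 : weightedPoint w = weightedPoint w') : w = w' := by
  classical
  have hd : (w - w').support ⊆ s := Finsupp.support_sub.trans (Finset.union_subset hw hw')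
  have hm : ∑ v ∈ s, (w - w') v = 0 := by
    rw [← totalMass_eq_sum hd, map_sub, h1, sub_self]
  have hp : ∑ v ∈ s, (w - w') v • v = 0 := by
    rw [← weightedPoint_eq_sum hd, map_sub, h2, sub_self]
  have := affineIndependent_iff.1 hs Finset.univ (fun v => (w - w') v)
    (by rw [← hm]; exact Finset.sum_coe_sort s (fun v => (w - w') v))
    (by rw [← hp]; exact Finset.sum_coe_sort s (fun v => (w - w') v • v))
  rw [← sub_eq_zero]
  ext v
  by_cases hv : v ∈ s
  · exact this ⟨v, hv⟩ (Finset.mem_univ _)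
  · exact Finsupp.notMem_support_iff.1 fun h => hv (hd h)

/-- A family of simplices in which barycentric weights are determined by the point is a simplicial
complex. -/
def complexOfUnique (𝓕 : Set (Finset E)) (hne : ∀ s ∈ 𝓕, s.Nonempty)
    (hdown : ∀ s ∈ 𝓕, ∀ t ⊆ s, t.Nonempty → t ∈ 𝓕)
    (huniq : ∀ w w', IsBary 𝓕 w → IsBary 𝓕 w' → weightedPoint w = weightedPoint w' → w = w') :
    SimplicialComplex ℝ E where
  faces := 𝓕
  isRelLowerSet_faces := fun s hs => ⟨hne s hs, fun t hts ht => hdown s hs t hts ht⟩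
  indep := by
    classical
    intro s hs
    by_contra h
    -- By Radon, affinely dependent vertices would give a point with two systems of weights of
    -- disjoint support, against uniqueness.
    obtain ⟨A, x, hx, hx'⟩ := Convex.radon_partition h
    have aux : ∀ J : Set s, x ∈ convexHull ℝ ((↑) '' J : Set E) →
        ∃ w : E →₀ ℝ, IsBary 𝓕 w ∧ (∀ v ∈ w.support, v ∈ ((↑) '' J : Set E)) ∧
          weightedPoint w = x := by
      intro J hJ
      have hc : (((Finset.univ.filter (· ∈ J)).map (Function.Embedding.subtype _) : Finset E) :
          Set E) = (↑) '' J := by ext; simp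
      rw [← hc] at hJ
      obtain ⟨w, h0, hsup, h1, h2⟩ := exists_weights_of_mem_convexHull hJ
      have hsup' : ∀ v ∈ w.support, v ∈ ((↑) '' J : Set E) := fun v hv => hc ▸ hsup hv
      refine ⟨w, ⟨h0, ?_, h1⟩, hsup', h2⟩
      refine hdown s hs _ (fun v hv => ?_) ?_
      · obtain ⟨u, -, rfl⟩ := hsup' v hv
        exact u.2
      · rw [Finsupp.support_nonempty_iff]
        rintro rfl
        simp at h1
    obtain ⟨w, hw, hwI, hwx⟩ := aux A hx
    obtain ⟨w', hw', hwI', hwx'⟩ := aux Aᶜ hx'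
    obtain rfl := huniq w w' hw hw' (hwx.trans hwx'.symm)
    obtain ⟨v, hv⟩ := hw.support_nonempty
    obtain ⟨u, hu, rfl⟩ := hwI v hv
    obtain ⟨u', hu', h⟩ := hwI' _ hv
    exact hu' (Subtype.ext h ▸ hu)
  inter_subset_convexHull := by
    rintro s t hs ht x ⟨hxs, hxt⟩
    obtain ⟨w, h0, hsup, h1, h2⟩ := exists_weights_of_mem_convexHull hxs
    obtain ⟨w', h0', hsup', h1', h2'⟩ := exists_weights_of_mem_convexHull hxt
    have hn : ∀ w : E →₀ ℝ, totalMass w = 1 → w.support.Nonempty := by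
      intro w h
      rw [Finsupp.support_nonempty_iff]
      rintro rfl
      simp at h
    -- The unique weights of a common point are supported in both simplices, hence in their
    -- intersection.
    obtain rfl := huniq w w' ⟨h0, hdown s hs _ hsup (hn _ h1), h1⟩
      ⟨h0', hdown t ht _ hsup' (hn _ h1'), h1'⟩ (h2.trans h2'.symm)
    rw [← h2]
    exact weightedPoint_mem_convexHull h0 (fun v hv => ⟨hsup hv, hsup' hv⟩) h1

namespace Geometry.SimplicialComplex

variable {K : SimplicialComplex ℝ E}

theorem exists_isBary_of_mem_face {s : Finset E} (hs : s ∈ K.faces) {x : E}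
    (hx : x ∈ convexHull ℝ (s : Set E)) :
    ∃ w, IsBary K.faces w ∧ w.support ⊆ s ∧ weightedPoint w = x := by
  obtain ⟨w, h0, hsup, h1, h2⟩ := exists_weights_of_mem_convexHull hx
  refine ⟨w, ⟨h0, K.down_closed hs hsup ?_, h1⟩, hsup, h2⟩
  rw [Finsupp.support_nonempty_iff]
  rintro rfl
  simp at h1

theorem weightedPoint_mem_space {w : E →₀ ℝ} (hw : IsBary K.faces w) :
    weightedPoint w ∈ K.space :=
  mem_space_iff.2 ⟨_, hw.support_mem, weightedPoint_mem_convexHull hw.nonneg subset_rfl hw.mass⟩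

/-- The point lies in the hull of the intersection of the two supports; weights `u` found there
agree with both `w` and `w'` by affine independence in each simplex. -/
theorem isBary_unique {w w' : E →₀ ℝ} (hw : IsBary K.faces w) (hw' : IsBary K.faces w')
    (h : weightedPoint w = weightedPoint w') : w = w' := by
  classical
  have hx := K.inter_subset_convexHull hw.support_mem hw'.support_mem
    ⟨weightedPoint_mem_convexHull hw.nonneg subset_rfl hw.mass,
      h ▸ weightedPoint_mem_convexHull hw'.nonneg subset_rfl hw'.mass⟩
  rw [← Finset.coe_inter] at hx
  obtain ⟨u, -, hu, h1, h2⟩ := exists_weights_of_mem_convexHull hx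
  have e1 : u = w := eq_of_affineIndependent (K.indep hw.support_mem)
    (hu.trans Finset.inter_subset_left) subset_rfl (h1.trans hw.mass.symm) h2
  have e2 : u = w' := eq_of_affineIndependent (K.indep hw'.support_mem)
    (hu.trans Finset.inter_subset_right) subset_rfl (h1.trans hw'.mass.symm) (h2.trans h)
  exact e1.symm.trans e2

open Classical in
/-- The barycentric weights of a point of the polyhedron of `K`. -/
def bary (K : SimplicialComplex ℝ E) (x : E) : E →₀ ℝ :=
  if h : ∃ w, IsBary K.faces w ∧ weightedPoint w = x then h.choose else 0

theorem bary_spec {x : E} (hx : x ∈ K.space) :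
    IsBary K.faces (K.bary x) ∧ weightedPoint (K.bary x) = x := by
  obtain ⟨s, hs, hxs⟩ := mem_space_iff.1 hx
  obtain ⟨w, hw, -, hwx⟩ := exists_isBary_of_mem_face hs hxs
  have h : ∃ w, IsBary K.faces w ∧ weightedPoint w = x := ⟨w, hw, hwx⟩
  rw [bary, dif_pos h]
  exact h.choose_spec

theorem isBary_bary {x : E} (hx : x ∈ K.space) : IsBary K.faces (K.bary x) := (bary_spec hx).1

theorem weightedPoint_bary {x : E} (hx : x ∈ K.space) : weightedPoint (K.bary x) = x :=
  (bary_spec hx).2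

theorem bary_weightedPoint {w : E →₀ ℝ} (hw : IsBary K.faces w) :
    K.bary (weightedPoint w) = w :=
  have h := bary_spec (weightedPoint_mem_space hw)
  isBary_unique h.1 hw h.2

theorem singleton_mem {s : Finset E} (hs : s ∈ K.faces) {v : E} (hv : v ∈ s) :
    {v} ∈ K.faces :=
  K.down_closed hs (Finset.singleton_subset_iff.2 hv) (Finset.singleton_nonempty v)

theorem isBary_single {v : E} (hv : {v} ∈ K.faces) :
    IsBary K.faces (Finsupp.single v 1) := by
  classical
  refine ⟨fun u => ?_, ?_, totalMass_single v 1⟩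
  · rw [Finsupp.single_apply]
    split_ifs <;> norm_num
  · rwa [Finsupp.support_single v one_ne_zero]

theorem bary_vertex {v : E} (hv : {v} ∈ K.faces) : K.bary v = Finsupp.single v 1 := by
  have := bary_weightedPoint (isBary_single hv)
  rwa [weightedPoint_single, one_smul] at this

open Classical in
/-- The vertices of a finite complex. -/
def vertexFinset (K : SimplicialComplex ℝ E) : Finset E :=
  if h : K.faces.Finite then h.toFinset.sup id else ∅

theorem subset_vertexFinset (hK : K.faces.Finite) {s : Finset E} (hs : s ∈ K.faces) :
    s ⊆ K.vertexFinset := by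
  classical
  rw [vertexFinset, dif_pos hK]
  exact Finset.le_sup (f := id) (hK.mem_toFinset.2 hs)

end Geometry.SimplicialComplex

end Barycentric

/-! ### Continuity of barycentric coordinates -/

section BarycentricTopology

variable {E : Type*} [NormedAddCommGroup E] [NormedSpace ℝ E]

namespace Geometry.SimplicialComplex

variable {K : SimplicialComplex ℝ E}

/-- The functions on `E` given by barycentric weights form a compact space when `K` is finite. -/
theorem isCompact_weights (hK : K.faces.Finite) :
    IsCompact {f : E → ℝ | ∃ w, IsBary K.faces w ∧ ⇑w = f} := by
  have hs : ∀ s : Finset E, IsCompact {f : E → ℝ | (∀ v, f v ∈ Set.Icc (0 : ℝ) 1) ∧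
      (∀ v ∉ s, f v = 0) ∧ ∑ v ∈ s, f v = 1} := by
    intro s
    have hc : IsCompact (Set.pi Set.univ fun _ : E => Set.Icc (0 : ℝ) 1) :=
      isCompact_univ_pi fun _ => isCompact_Icc
    have hcl : IsClosed {f : E → ℝ | (∀ v ∉ s, f v = 0) ∧ ∑ v ∈ s, f v = 1} := by
      refine IsClosed.inter (s₁ := {f : E → ℝ | ∀ v ∉ s, f v = 0})
        (s₂ := {f : E → ℝ | ∑ v ∈ s, f v = 1}) ?_ ?_
      · simp only [Set.ofPred_forall]
        exact isClosed_iInter fun v => isClosed_iInter fun _ =>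
          isClosed_eq (continuous_apply v) continuous_const
      · exact isClosed_eq (continuous_finsetSum _ fun v _ => continuous_apply v) continuous_const
    convert hc.inter_right hcl using 1
    ext f
    simp only [Set.mem_ofPred_eq, Set.mem_inter_iff, Set.mem_pi, Set.mem_univ, true_implies]
  convert hK.isCompact_biUnion fun s _ => hs s using 1
  ext f
  simp only [Set.mem_ofPred_eq, Set.mem_iUnion, exists_prop]
  constructor
  · rintro ⟨w, hw, rfl⟩
    have hsum := totalMass_eq_sum (w := w) subset_rfl
    rw [hw.mass] at hsum
    refine ⟨w.support, hw.support_mem, fun v => ⟨hw.nonneg v, ?_⟩,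
      fun v hv => Finsupp.notMem_support_iff.1 hv, hsum.symm⟩
    by_cases hv : v ∈ w.support
    · rw [hsum]
      exact Finset.single_le_sum (f := fun v => w v) (fun u _ => hw.nonneg u) hv
    · rw [Finsupp.notMem_support_iff.1 hv]
      norm_num
  · rintro ⟨s, hs, h0, h1, h2⟩
    have hsup : (Finsupp.onFinset s f fun v hv => by by_contra h; exact hv (h1 v h)).support ⊆ s :=
      Finsupp.support_onFinset_subset
    refine ⟨Finsupp.onFinset s f fun v hv => by by_contra h; exact hv (h1 v h),
      ⟨fun v => (h0 v).1, K.down_closed hs hsup ?_, ?_⟩, rfl⟩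
    · rw [Finsupp.support_nonempty_iff]
      intro h
      have : f = 0 := by
        ext v
        simpa using DFunLike.congr_fun h v
      simp [this] at h2
    · rw [totalMass_eq_sum hsup]
      exact h2

/-- The map from weights to points is a continuous bijection from a compact space to a Hausdorff
one, so its inverse is continuous. -/
theorem continuous_bary (hK : K.faces.Finite) :
    Continuous fun x : K.space => (⇑(K.bary x) : E → ℝ) := by
  set W : Set (E → ℝ) := {f : E → ℝ | ∃ w, IsBary K.faces w ∧ ⇑w = f} with hW
  have : CompactSpace W := isCompact_iff_compactSpace.1 (isCompact_weights hK)
  have hpt : ∀ w, IsBary K.faces w → weightedPoint w = ∑ v ∈ K.vertexFinset, w v • v :=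
    fun w hw => weightedPoint_eq_sum (subset_vertexFinset hK hw.support_mem)
  let e : W ≃ K.space :=
    { toFun := fun f => ⟨∑ v ∈ K.vertexFinset, f.1 v • v, by
        obtain ⟨_, w, hw, rfl⟩ := f
        exact hpt w hw ▸ weightedPoint_mem_space hw⟩
      invFun := fun x => ⟨K.bary x, K.bary x, isBary_bary x.2, rfl⟩
      left_inv := by
        rintro ⟨_, w, hw, rfl⟩
        refine Subtype.ext ?_
        simp only [← hpt w hw, bary_weightedPoint hw]
      right_inv := by
        intro x
        refine Subtype.ext ?_
        simp only [← hpt _ (isBary_bary x.2), weightedPoint_bary x.2] }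
  have he : Continuous e := by
    refine Continuous.subtype_mk (continuous_finsetSum _ fun v _ => ?_) _
    exact ((continuous_apply v).comp continuous_subtype_val).smul continuous_const
  exact continuous_subtype_val.comp he.continuous_symm_of_equiv_compact_to_t2

theorem isCompact_space (hK : K.faces.Finite) : IsCompact K.space :=
  hK.isCompact_biUnion fun s _ => s.finite_toSet.isCompact_convexHull (𝕜 := ℝ)

theorem continuous_bary_apply (hK : K.faces.Finite) (v : E) :
    Continuous fun x : K.space => K.bary x v :=
  (continuous_apply v).comp (continuous_bary hK)

end Geometry.SimplicialComplex

end BarycentricTopology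

/-! ### Fine subdivisions by repeated bisection of edges -/

theorem IsFiniteSubdivision.trans {E : Type*} [AddCommGroup E] [Module ℝ E]
    {K K' K'' : SimplicialComplex ℝ E} (h : IsFiniteSubdivision K'' K')
    (h' : IsFiniteSubdivision K' K) : IsFiniteSubdivision K'' K where
  finite := h.finite
  space_eq := h.space_eq.trans h'.space_eq
  subset_face s hs := by
    obtain ⟨t, ht, hst⟩ := h.subset_face s hs
    obtain ⟨r, hr, htr⟩ := h'.subset_face t ht
    exact ⟨r, hr, hst.trans htr⟩

theorem IsFiniteSubdivision.refl {E : Type*} [AddCommGroup E] [Module ℝ E]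
    {K : SimplicialComplex ℝ E} (hK : K.faces.Finite) : IsFiniteSubdivision K K where
  finite := hK
  space_eq := rfl
  subset_face s hs := ⟨s, hs, subset_rfl⟩

section ShareWeights

variable {E : Type*}

/-- The weights in which the mass of `c` is shared out equally between `a` and `b`. -/
def shareWeights (a b c : E) (w : E →₀ ℝ) : E →₀ ℝ :=
  w.erase c + (Finsupp.single a (w c / 2) + Finsupp.single b (w c / 2))

theorem map_shareWeights {F : Type*} [AddCommGroup F] [Module ℝ F] (f : (E →₀ ℝ) →ₗ[ℝ] F)
    {a b c : E} (hf : (2⁻¹ : ℝ) • (f (Finsupp.single a 1) + f (Finsupp.single b 1)) =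
      f (Finsupp.single c 1)) (w : E →₀ ℝ) : f (shareWeights a b c w) = f w := by
  have h : ∀ (v : E) (r : ℝ), f (Finsupp.single v r) = r • f (Finsupp.single v 1) := by
    intro v r
    rw [← map_smul, Finsupp.smul_single, smul_eq_mul, mul_one]
  conv_rhs => rw [← Finsupp.erase_add_single c w]
  rw [shareWeights, map_add, map_add, map_add, h a, h b, h c, ← hf, ← smul_add, smul_smul,
    div_eq_mul_inv]

theorem totalMass_shareWeights (a b c : E) (w : E →₀ ℝ) :
    totalMass (shareWeights a b c w) = totalMass w :=
  map_shareWeights totalMass (by simp only [totalMass_single, smul_eq_mul]; norm_num) w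

variable {a b c : E}

theorem shareWeights_apply_self (hca : c ≠ a) (hcb : c ≠ b) (w : E →₀ ℝ) :
    shareWeights a b c w c = 0 := by
  simp [shareWeights, hca.symm, hcb.symm]

theorem shareWeights_apply_left (hab : a ≠ b) (hca : c ≠ a) (w : E →₀ ℝ) :
    shareWeights a b c w a = w a + w c / 2 := by
  simp [shareWeights, hca.symm, hab.symm, Finsupp.erase_ne]

theorem shareWeights_apply_right (hab : a ≠ b) (hcb : c ≠ b) (w : E →₀ ℝ) :
    shareWeights a b c w b = w b + w c / 2 := by
  simp [shareWeights, hcb.symm, hab, Finsupp.erase_ne]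

theorem shareWeights_apply_of_ne {v : E} (hva : v ≠ a) (hvb : v ≠ b) (hvc : v ≠ c)
    (w : E →₀ ℝ) : shareWeights a b c w v = w v := by
  simp [shareWeights, hva.symm, hvb.symm, Finsupp.erase_ne hvc]

end ShareWeights

section Midpoint

variable {E : Type*} [AddCommGroup E] [Module ℝ E] {a b c : E}

theorem weightedPoint_shareWeights (hc : c = (2⁻¹ : ℝ) • (a + b)) (w : E →₀ ℝ) :
    weightedPoint (shareWeights a b c w) = weightedPoint w :=
  map_shareWeights weightedPoint (by simp only [weightedPoint_single, one_smul, ← hc]) w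

theorem mem_convexHull_pair_of_eq (hc : c = (2⁻¹ : ℝ) • (a + b)) :
    c ∈ convexHull ℝ ({a, b} : Set E) := by
  rw [convexHull_pair, hc, smul_add]
  exact ⟨2⁻¹, 2⁻¹, by norm_num, by norm_num, by norm_num, rfl⟩

end Midpoint

section Bisection

variable {E : Type*} [AddCommGroup E] [Module ℝ E] [DecidableEq E]

/-- The simplices of the subdivision of `K` that bisects the edge `{a, b}` at `c`. -/
def bisectFaces (K : SimplicialComplex ℝ E) (a b c : E) : Set (Finset E) :=
  {t | t.Nonempty ∧ ¬ (a ∈ t ∧ b ∈ t) ∧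
    ((c ∉ t ∧ t ∈ K.faces) ∨ (c ∈ t ∧ t.erase c ∪ {a, b} ∈ K.faces))}

variable {K : SimplicialComplex ℝ E} {a b c : E}

/-- A vertex of `K` in the hull of a simplex is a vertex of that simplex, so the midpoint would
equal `a` or `b`. -/
theorem bisection_notMem (hab : a ≠ b) (hK : {a, b} ∈ K.faces) (hc : c = (2⁻¹ : ℝ) • (a + b))
    {s : Finset E} (hs : s ∈ K.faces) : c ∉ s := by
  intro hcs
  have hv : c ∈ K.vertices := SimplicialComplex.singleton_mem hs hcs
  have hmem := (SimplicialComplex.vertex_mem_convexHull_iff hv hK).1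
    (by rw [Finset.coe_pair]; exact mem_convexHull_pair_of_eq hc)
  have h2 : (2 : ℝ) • c = a + b := by rw [hc, smul_smul]; norm_num
  rw [two_smul] at h2
  rw [Finset.mem_insert, Finset.mem_singleton] at hmem
  rcases hmem with h | h
  · exact hab (add_left_cancel (h ▸ h2))
  · exact hab (add_right_cancel (h ▸ h2)).symm

/-- No new simplex contains both `a` and `b`, so one of their weights is 0. Thus the weight at `c`
can be recovered after sharing, which makes sharing injective and, with uniqueness of weights in
`K`, the bisected family a complex. -/
theorem min_shareWeights (hab : a ≠ b) (hca : c ≠ a) (hcb : c ≠ b) {w : E →₀ ℝ}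
    (hw : IsBary (bisectFaces K a b c) w) :
    min (shareWeights a b c w a) (shareWeights a b c w b) = w c / 2 := by
  rw [shareWeights_apply_left hab hca, shareWeights_apply_right hab hcb]
  have ha := hw.nonneg a
  have hb := hw.nonneg b
  have h := hw.support_mem.2.1
  rw [Finsupp.mem_support_iff, Finsupp.mem_support_iff, not_and_or, not_not, not_not] at h
  rcases h with h | h <;> rw [h]
  · rw [min_eq_left] <;> linarith
  · rw [min_eq_right] <;> linarith

theorem shareWeights_injective (hab : a ≠ b) (hca : c ≠ a) (hcb : c ≠ b) {w w' : E →₀ ℝ}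
    (hw : IsBary (bisectFaces K a b c) w) (hw' : IsBary (bisectFaces K a b c) w')
    (h : shareWeights a b c w = shareWeights a b c w') : w = w' := by
  have h1 := min_shareWeights hab hca hcb hw
  have h2 := min_shareWeights hab hca hcb hw'
  have hc : w c = w' c := by
    rw [h, h2] at h1
    linarith
  have hva := DFunLike.congr_fun h a
  have hvb := DFunLike.congr_fun h b
  rw [shareWeights_apply_left hab hca, shareWeights_apply_left hab hca, hc] at hva
  rw [shareWeights_apply_right hab hcb, shareWeights_apply_right hab hcb, hc] at hvb
  ext v
  by_cases ha : v = a
  · rw [ha]; linarith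
  by_cases hb : v = b
  · rw [hb]; linarith
  by_cases hvc : v = c
  · rw [hvc, hc]
  have hv := DFunLike.congr_fun h v
  rwa [shareWeights_apply_of_ne ha hb hvc, shareWeights_apply_of_ne ha hb hvc] at hv

theorem exists_face_of_mem_bisectFaces {t : Finset E} (ht : t ∈ bisectFaces K a b c) :
    ∃ s ∈ K.faces, (∀ v ∈ t, v ≠ c → v ∈ s) ∧ (c ∈ t → a ∈ s ∧ b ∈ s) := by
  obtain ⟨-, -, ⟨hc, h⟩ | ⟨-, h⟩⟩ := ht
  · exact ⟨t, h, fun v hv _ => hv, fun h => absurd h hc⟩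
  · exact ⟨_, h, fun v hv hvc => by simp [hv, hvc], fun _ => by simp⟩

theorem isBary_shareWeights (hab : a ≠ b) (hca : c ≠ a) (hcb : c ≠ b) {w : E →₀ ℝ}
    (hw : IsBary (bisectFaces K a b c) w) : IsBary K.faces (shareWeights a b c w) := by
  have hmass : totalMass (shareWeights a b c w) = 1 := by
    rw [totalMass_shareWeights, hw.mass]
  have hn : ∀ v, 0 ≤ shareWeights a b c w v := by
    intro v
    have hc0 := hw.nonneg c
    by_cases ha : v = a
    · rw [ha, shareWeights_apply_left hab hca]
      linarith [hw.nonneg a]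
    by_cases hb : v = b
    · rw [hb, shareWeights_apply_right hab hcb]
      linarith [hw.nonneg b]
    by_cases hvc : v = c
    · rw [hvc, shareWeights_apply_self hca hcb]
    rw [shareWeights_apply_of_ne ha hb hvc]
    exact hw.nonneg v
  refine ⟨hn, ?_, hmass⟩
  obtain ⟨s, hs, hsub, hsc⟩ := exists_face_of_mem_bisectFaces hw.support_mem
  refine K.down_closed hs (fun v hv => ?_) ?_
  · rw [Finsupp.mem_support_iff] at hv
    have hvc : v ≠ c := by
      rintro rfl
      exact hv (shareWeights_apply_self hca hcb w)
    by_cases hwv : w v = 0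
    · by_cases hwc : w c = 0
      · refine absurd ?_ hv
        simp [shareWeights, hwc, hwv]
      · have := hsc (Finsupp.mem_support_iff.2 hwc)
        by_cases ha : v = a
        · exact ha ▸ this.1
        by_cases hb : v = b
        · exact hb ▸ this.2
        rw [shareWeights_apply_of_ne ha hb hvc] at hv
        exact absurd hwv hv
    · exact hsub v (Finsupp.mem_support_iff.2 hwv) hvc
  · rw [Finsupp.support_nonempty_iff]
    intro h
    simp [h] at hmass

theorem exists_isBary_bisectFaces (hab : a ≠ b) (hca : c ≠ a) (hcb : c ≠ b)
    (hcK : ∀ s ∈ K.faces, c ∉ s)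
    (hc : c = (2⁻¹ : ℝ) • (a + b)) {u : E →₀ ℝ} (hu : IsBary K.faces u) :
    ∃ w, IsBary (bisectFaces K a b c) w ∧ weightedPoint w = weightedPoint u := by
  have huc : u c = 0 := Finsupp.notMem_support_iff.1 (hcK _ hu.support_mem)
  -- Moving the common mass `r` from each of `a` and `b` to the midpoint keeps the point and empties
  -- one of the two ends.
  set r := min (u a) (u b) with hr
  have hr0 : 0 ≤ r := le_min (hu.nonneg a) (hu.nonneg b)
  have hra : r ≤ u a := min_le_left _ _
  have hrb : r ≤ u b := min_le_right _ _
  set w : E →₀ ℝ := u - Finsupp.single a r - Finsupp.single b r + Finsupp.single c (2 * r) with hw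
  have wa : w a = u a - r := by simp [hw, hab.symm, hca]
  have wb : w b = u b - r := by simp [hw, hab, hcb]
  have wc : w c = 2 * r := by simp [hw, hca.symm, hcb.symm, huc]
  have wv : ∀ v, v ≠ a → v ≠ b → v ≠ c → w v = u v := by
    intro v h1 h2 h3
    simp [hw, h1.symm, h2.symm, h3.symm]
  have hmass : totalMass w = 1 := by
    rw [hw, map_add, map_sub, map_sub, hu.mass, totalMass_single, totalMass_single,
      totalMass_single]
    ring
  have hsub : ∀ v ∈ w.support, v ≠ c → v ∈ u.support := by
    intro v hv hvc
    rw [Finsupp.mem_support_iff] at hv ⊢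
    by_cases ha : v = a
    · rw [ha, wa] at hv
      rw [ha]
      intro h
      apply hv
      rw [h] at hra
      linarith
    by_cases hb : v = b
    · rw [hb, wb] at hv
      rw [hb]
      intro h
      apply hv
      rw [h] at hrb
      linarith
    rwa [wv v ha hb hvc] at hv
  have hne : w.support.Nonempty := by
    rw [Finsupp.support_nonempty_iff]
    intro h
    simp [h] at hmass
  refine ⟨w, ⟨fun v => ?_, ⟨hne, ?_, ?_⟩, hmass⟩, ?_⟩
  · by_cases ha : v = a
    · rw [ha, wa]; linarith
    by_cases hb : v = b
    · rw [hb, wb]; linarith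
    by_cases hvc : v = c
    · rw [hvc, wc]; linarith
    rw [wv v ha hb hvc]
    exact hu.nonneg v
  · rw [Finsupp.mem_support_iff, Finsupp.mem_support_iff, wa, wb]
    rintro ⟨h1, h2⟩
    rcases min_choice (u a) (u b) with h | h
    · exact h1 (by rw [hr, h, sub_self])
    · exact h2 (by rw [hr, h, sub_self])
  · by_cases h : c ∈ w.support
    · refine Or.inr ⟨h, ?_⟩
      rw [Finsupp.mem_support_iff, wc] at h
      have hrpos : 0 < r := lt_of_le_of_ne hr0 fun h0 => h (by rw [← h0, mul_zero])
      refine K.down_closed hu.support_mem (fun v hv => ?_) (by simp)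
      rw [Finset.mem_union, Finset.mem_erase, Finset.mem_insert, Finset.mem_singleton] at hv
      rcases hv with ⟨h1, h2⟩ | rfl | rfl
      · exact hsub v h2 h1
      · exact Finsupp.mem_support_iff.2 (by linarith)
      · exact Finsupp.mem_support_iff.2 (by linarith)
    · refine Or.inl ⟨h, K.down_closed hu.support_mem (fun v hv => hsub v hv ?_) hne⟩
      rintro rfl
      exact h hv
  · rw [hw, map_add, map_sub, map_sub, weightedPoint_single, weightedPoint_single,
      weightedPoint_single, mul_comm, mul_smul, hc, smul_smul (2 : ℝ), mul_inv_cancel₀ two_ne_zero,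
      one_smul, smul_add]
    abel

end Bisection

/-- Bisecting an edge. -/
theorem exists_bisection {E : Type*} [AddCommGroup E] [Module ℝ E] [DecidableEq E]
    {K : SimplicialComplex ℝ E} (hfin : K.faces.Finite) {a b : E} (hab : a ≠ b)
    (hK : {a, b} ∈ K.faces) :
    ∃ K' : SimplicialComplex ℝ E, IsFiniteSubdivision K' K ∧
      ∀ x y, x ≠ y → {x, y} ∈ K'.faces →
        ({x, y} ∈ K.faces ∧ ¬ (a ∈ ({x, y} : Finset E) ∧ b ∈ ({x, y} : Finset E))) ∨
        (x = (2⁻¹ : ℝ) • (a + b) ∧ {y, a, b} ∈ K.faces) ∨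
        (y = (2⁻¹ : ℝ) • (a + b) ∧ {x, a, b} ∈ K.faces) := by
  obtain ⟨c, hc⟩ : ∃ c : E, c = (2⁻¹ : ℝ) • (a + b) := ⟨_, rfl⟩
  have hcK : ∀ s ∈ K.faces, c ∉ s := fun s hs => bisection_notMem hab hK hc hs
  have hcab := hcK _ hK
  have hca : c ≠ a := by rintro rfl; simp at hcab
  have hcb : c ≠ b := by rintro rfl; simp at hcab
  -- Sharing the mass of `c` turns new weights into weights of `K` for the same point, so uniqueness
  -- is inherited from `K`.
  let K' : SimplicialComplex ℝ E := complexOfUnique (bisectFaces K a b c) (fun s hs => hs.1)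
    (by
      rintro s ⟨-, hs, hs'⟩ t hts ht
      refine ⟨ht, fun h => hs ⟨hts h.1, hts h.2⟩, ?_⟩
      by_cases hct : c ∈ t
      · rcases hs' with ⟨h, -⟩ | ⟨-, h⟩
        · exact absurd (hts hct) h
        · exact Or.inr ⟨hct, K.down_closed h
            (Finset.union_subset_union_left (Finset.erase_subset_erase c hts)) (by simp)⟩
      · refine Or.inl ⟨hct, ?_⟩
        rcases hs' with ⟨-, h⟩ | ⟨-, h⟩
        · exact K.down_closed h hts ht
        · refine K.down_closed h (fun v hv => Finset.mem_union_left _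
            (Finset.mem_erase.2 ⟨?_, hts hv⟩)) ht
          rintro rfl
          exact hct hv)
    (by
      intro w w' hw hw' h
      refine shareWeights_injective hab hca hcb hw hw' (SimplicialComplex.isBary_unique
        (isBary_shareWeights hab hca hcb hw) (isBary_shareWeights hab hca hcb hw') ?_)
      rw [weightedPoint_shareWeights hc, weightedPoint_shareWeights hc, h])
  have hface : ∀ s ∈ K'.faces, ∃ t ∈ K.faces,
      convexHull ℝ (s : Set E) ⊆ convexHull ℝ (t : Set E) := by
    intro s hs
    obtain ⟨t, ht, h1, h2⟩ := exists_face_of_mem_bisectFaces (K := K) hs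
    refine ⟨t, ht, convexHull_min (fun v hv => ?_) (convex_convexHull ℝ _)⟩
    by_cases hvc : v = c
    · have h3 := h2 (hvc ▸ hv)
      rw [hvc]
      refine convexHull_mono ?_ (mem_convexHull_pair_of_eq hc)
      rintro _ (rfl | rfl)
      exacts [h3.1, h3.2]
    · exact subset_convexHull ℝ _ (h1 v hv hvc)
  refine ⟨K', ⟨?_, ?_, hface⟩, ?_⟩
  · refine (insert c K.vertexFinset).powerset.finite_toSet.subset fun s hs => ?_
    obtain ⟨t, ht, h1, -⟩ := exists_face_of_mem_bisectFaces (K := K) hs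
    rw [Finset.mem_coe, Finset.mem_powerset]
    intro v hv
    by_cases hvc : v = c
    · simp [hvc]
    · exact Finset.mem_insert_of_mem (SimplicialComplex.subset_vertexFinset hfin ht (h1 v hv hvc))
  · refine Set.Subset.antisymm (fun x hx => ?_) (fun x hx => ?_)
    · obtain ⟨s, hs, hxs⟩ := SimplicialComplex.mem_space_iff.1 hx
      obtain ⟨t, ht, hst⟩ := hface s hs
      exact SimplicialComplex.mem_space_iff.2 ⟨t, ht, hst hxs⟩
    · obtain ⟨h1, h2⟩ := SimplicialComplex.bary_spec hx
      obtain ⟨w, hw, hwx⟩ := exists_isBary_bisectFaces hab hca hcb hcK hc h1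
      rw [← h2, ← hwx]
      exact SimplicialComplex.weightedPoint_mem_space (K := K') hw
  · rintro x y hxy ⟨-, h1, ⟨-, h⟩ | ⟨h3, h⟩⟩
    · exact Or.inl ⟨h, h1⟩
    · rw [← hc]
      rw [Finset.mem_insert, Finset.mem_singleton] at h3
      rcases h3 with rfl | rfl
      · refine Or.inr (Or.inl ⟨rfl, ?_⟩)
        rwa [Finset.erase_insert (by simpa using hxy), Finset.singleton_union] at h
      · refine Or.inr (Or.inr ⟨rfl, ?_⟩)
        rwa [Finset.pair_comm, Finset.erase_insert (by simpa using hxy.symm),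
          Finset.singleton_union] at h

section Mesh

variable {E : Type*} [AddCommGroup E] [Module ℝ E]
  {F : Type*} [NormedAddCommGroup F] [InnerProductSpace ℝ F]

/-- The edges of `K` have length at most `D` after the linear map `L`. -/
def EdgesLE (K : SimplicialComplex ℝ E) (L : E →ₗ[ℝ] F) (D : ℝ) : Prop :=
  ∀ s ∈ K.faces, ∀ x ∈ s, ∀ y ∈ s, ‖L x - L y‖ ≤ D

/-- By the parallelogram law the squared median is at most (4 - 0.81) D² / 4 = 0.7975 D², which is
below (0.9 D)² = 0.81 D². This is where a Euclidean norm is needed. -/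
theorem norm_sub_midpoint_le {p q y : F} {D : ℝ} (hD : 0 ≤ D) (hp : ‖p - y‖ ≤ D)
    (hq : ‖q - y‖ ≤ D) (hpq : 0.9 * D < ‖p - q‖) :
    ‖(2⁻¹ : ℝ) • (p + q) - y‖ ≤ 0.9 * D := by
  have h1 := parallelogram_law_with_norm ℝ (p - y) (q - y)
  have h2 : (2⁻¹ : ℝ) • (p + q) - y = (2⁻¹ : ℝ) • (p - y + (q - y)) := by
    have : y = (2⁻¹ : ℝ) • (y + y) := by rw [← two_smul ℝ y, smul_smul]; norm_num
    conv_lhs => rw [this]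
    rw [← smul_sub]
    congr 1
    abel
  have h3 : p - y - (q - y) = p - q := by abel
  rw [h3] at h1
  rw [h2, norm_smul, Real.norm_of_nonneg (by norm_num)]
  have hp2 := mul_self_le_mul_self (norm_nonneg _) hp
  have hq2 := mul_self_le_mul_self (norm_nonneg _) hq
  have hpq2 := mul_self_le_mul_self (by positivity) hpq.le
  refine abs_le_of_sq_le_sq' ?_ (by positivity) |>.2
  nlinarith

theorem exists_subdivision_edgesLE_mul {K : SimplicialComplex ℝ E} (hfin : K.faces.Finite)
    (L : E →ₗ[ℝ] F) {D : ℝ} (hD : 0 ≤ D) (hK : EdgesLE K L D) :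
    ∃ K' : SimplicialComplex ℝ E, IsFiniteSubdivision K' K ∧ EdgesLE K' L (0.9 * D) := by
  classical
  -- Induction on the number of edges longer than 0.9 D: bisecting one of them destroys it and
  -- creates only edges of length at most 0.9 D.
  generalize hn : {s ∈ K.faces | ∃ x y, s = {x, y} ∧ 0.9 * D < ‖L x - L y‖}.ncard = n
  induction n using Nat.strong_induction_on generalizing K with
  | _ n ih =>
  by_cases h : EdgesLE K L (0.9 * D)
  · exact ⟨K, .refl hfin, h⟩
  simp only [EdgesLE, not_forall, not_le] at h
  obtain ⟨s, hs, a, ha, b, hb, hlt⟩ := h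
  have hab : a ≠ b := by
    rintro rfl
    rw [sub_self, norm_zero] at hlt
    linarith
  have hKab : {a, b} ∈ K.faces := K.down_closed hs (by
    intro v hv
    rw [Finset.mem_insert, Finset.mem_singleton] at hv
    rcases hv with rfl | rfl <;> assumption) (by simp)
  obtain ⟨K', hK', hedge⟩ := exists_bisection hfin hab hKab
  have hmid : ∀ y, {y, a, b} ∈ K.faces → ‖L ((2⁻¹ : ℝ) • (a + b)) - L y‖ ≤ 0.9 * D := by
    intro y hy
    rw [map_smul, map_add]
    exact norm_sub_midpoint_le hD (hK _ hy _ (by simp) _ (by simp))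
      (hK _ hy _ (by simp) _ (by simp)) hlt
  have hnew : ∀ x y, x ≠ y → {x, y} ∈ K'.faces → ({x, y} ∈ K.faces ∧
      ¬ (a ∈ ({x, y} : Finset E) ∧ b ∈ ({x, y} : Finset E))) ∨ ‖L x - L y‖ ≤ 0.9 * D := by
    intro x y hxy hface
    rcases hedge x y hxy hface with h | ⟨rfl, h⟩ | ⟨rfl, h⟩
    · exact Or.inl h
    · exact Or.inr (hmid y h)
    · rw [norm_sub_rev]
      exact Or.inr (hmid x h)
  have hK'D : EdgesLE K' L D := by
    intro t ht x hx y hy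
    by_cases hxy : x = y
    · rw [hxy, sub_self, norm_zero]; exact hD
    have hpair : {x, y} ∈ K'.faces := K'.down_closed ht (by
      intro v hv
      rw [Finset.mem_insert, Finset.mem_singleton] at hv
      rcases hv with rfl | rfl <;> assumption) (by simp)
    rcases hnew x y hxy hpair with h | h
    · exact hK _ h.1 _ (by simp) _ (by simp)
    · linarith
  suffices hcard : {s ∈ K'.faces | ∃ x y, s = {x, y} ∧ 0.9 * D < ‖L x - L y‖}.ncard < n by
    obtain ⟨K'', h1, h2⟩ := ih _ hcard hK'.finite hK'D rfl
    exact ⟨K'', h1.trans hK', h2⟩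
  rw [← hn]
  refine Set.ncard_lt_ncard ⟨?_, ?_⟩ (hfin.subset (Set.sep_subset _ _))
  · rintro _ ⟨ht, x, y, rfl, hxy⟩
    have hne : x ≠ y := by
      rintro rfl
      rw [sub_self, norm_zero] at hxy
      linarith
    rcases hnew x y hne ht with h | h
    · exact ⟨h.1, x, y, rfl, hxy⟩
    · exact absurd hxy h.not_gt
  · intro hsub
    obtain ⟨ht, -⟩ := hsub ⟨hKab, a, b, rfl, hlt⟩
    rcases hnew a b hab ht with h | h
    · exact h.2 (by simp)
    · exact absurd hlt h.not_gt

theorem exists_subdivision_edgesLE {K : SimplicialComplex ℝ E} (hfin : K.faces.Finite)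
    (L : E →ₗ[ℝ] F) {ε : ℝ} (hε : 0 < ε) :
    ∃ K' : SimplicialComplex ℝ E, IsFiniteSubdivision K' K ∧ EdgesLE K' L ε := by
  obtain ⟨D, hD, hKD⟩ : ∃ D : ℝ, 0 ≤ D ∧ EdgesLE K L D := by
    refine ⟨∑ x ∈ K.vertexFinset, ∑ y ∈ K.vertexFinset, ‖L x - L y‖, by positivity, ?_⟩
    intro s hs x hx y hy
    have hV := SimplicialComplex.subset_vertexFinset hfin hs
    refine (Finset.single_le_sum (f := fun y => ‖L x - L y‖) (fun _ _ => norm_nonneg _)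
      (hV hy)).trans ?_
    exact Finset.single_le_sum (f := fun x => ∑ y ∈ K.vertexFinset, ‖L x - L y‖)
      (fun _ _ => by positivity) (hV hx)
  have key : ∀ n : ℕ, ∃ K' : SimplicialComplex ℝ E, IsFiniteSubdivision K' K ∧
      EdgesLE K' L (0.9 ^ n * D) := by
    intro n
    induction n with
    | zero => exact ⟨K, .refl hfin, by simpa using hKD⟩
    | succ n ih =>
      obtain ⟨K', h1, h2⟩ := ih
      obtain ⟨K'', h3, h4⟩ := exists_subdivision_edgesLE_mul h1.finite L (by positivity) h2
      exact ⟨K'', h3.trans h1, by rwa [pow_succ', mul_assoc]⟩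
  have hlim : Tendsto (fun n : ℕ => (0.9 : ℝ) ^ n * D) atTop (nhds (0 * D)) :=
    (tendsto_pow_atTop_nhds_zero_of_lt_one (by norm_num) (by norm_num)).mul_const D
  rw [zero_mul] at hlim
  obtain ⟨n, hn⟩ := (hlim.eventually_lt_const hε).exists
  obtain ⟨K', h1, h2⟩ := key n
  exact ⟨K', h1, fun s hs x hx y hy => (h2 s hs x hx y hy).trans hn.le⟩

end Mesh

/-- Finite simplicial complexes have arbitrarily fine finite subdivisions. -/
theorem exists_subdivision_dist_le {E : Type*} [NormedAddCommGroup E] [NormedSpace ℝ E]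
    {K : SimplicialComplex ℝ E} (hfin : K.faces.Finite) {ε : ℝ} (hε : 0 < ε) :
    ∃ K' : SimplicialComplex ℝ E, IsFiniteSubdivision K' K ∧
      ∀ s ∈ K'.faces, ∀ x ∈ s, ∀ y ∈ s, dist x y ≤ ε := by
  -- The norm of `E` need not be Euclidean. On the finite-dimensional span of the vertices it is
  -- bounded by a multiple of a Euclidean norm, in which edges can be shortened.
  let V : Submodule ℝ E := Submodule.span ℝ (K.vertexFinset : Set E)
  have : FiniteDimensional ℝ V := FiniteDimensional.span_finset ℝ K.vertexFinset
  let e := toEuclidean (E := V)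
  obtain ⟨L, hL⟩ := LinearMap.exists_extend (e.toLinearEquiv.toLinearMap)
  have hspace : K.space ⊆ V := by
    intro x hx
    obtain ⟨s, hs, hxs⟩ := SimplicialComplex.mem_space_iff.1 hx
    refine convexHull_min (fun v hv => ?_) V.convex hxs
    exact Submodule.subset_span (SimplicialComplex.subset_vertexFinset hfin hs hv)
  set C := ‖e.symm.toContinuousLinearMap‖ + 1 with hC
  have hC0 : 0 < C := by positivity
  have hbound : ∀ x ∈ V, ‖x‖ ≤ C * ‖L x‖ := by
    intro x hx
    have h1 : L x = e ⟨x, hx⟩ := LinearMap.congr_fun hL ⟨x, hx⟩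
    have h2 := e.symm.toContinuousLinearMap.le_opNorm (e ⟨x, hx⟩)
    rw [h1]
    simp only [ContinuousLinearEquiv.coe_coe, ContinuousLinearEquiv.symm_apply_apply] at h2
    refine (h2.trans ?_)
    gcongr
    linarith
  obtain ⟨K', h1, h2⟩ := exists_subdivision_edgesLE hfin L (div_pos hε hC0)
  refine ⟨K', h1, fun s hs x hx y hy => ?_⟩
  have hV : ∀ v ∈ s, v ∈ V := fun v hv =>
    hspace (h1.space_eq ▸ K'.subset_space hs hv)
  have h3 := hbound (x - y) (V.sub_mem (hV x hx) (hV y hy))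
  have h4 := h2 s hs x hx y hy
  rw [map_sub] at h3
  rw [dist_eq_norm]
  calc ‖x - y‖ ≤ C * ‖L x - L y‖ := h3
    _ ≤ C * (ε / C) := by gcongr
    _ = ε := by field_simp

/-! ### Finite generation of fundamental groups -/

section PathClass

variable {X : Type*} [TopologicalSpace X]

/-- The class of a path, as a morphism of the fundamental groupoid. -/
def pathClass {x y : X} (γ : Path x y) : FundamentalGroupoid.mk x ⟶ FundamentalGroupoid.mk y :=
  Path.Homotopic.Quotient.mk γ

theorem pathClass_eq {x y : X} {γ δ : Path x y} (h : γ.Homotopic δ) :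
    pathClass γ = pathClass δ :=
  Path.Homotopic.Quotient.eq.2 h

theorem pathClass_trans {x y z : X} (γ : Path x y) (δ : Path y z) :
    pathClass (γ.trans δ) = pathClass γ ≫ pathClass δ := rfl

theorem pathClass_symm {x y : X} (γ : Path x y) :
    pathClass γ.symm = Groupoid.inv (pathClass γ) := rfl

theorem exists_pathClass {x y : X} (p : FundamentalGroupoid.mk x ⟶ FundamentalGroupoid.mk y) :
    ∃ γ : Path x y, pathClass γ = p :=
  Path.Homotopic.Quotient.mk_surjective p

theorem pathClass_eq_of_isSimplyConnected {S : Set X} (hS : IsSimplyConnected S) {x y : X}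
    (γ δ : Path x y) (hγ : ∀ t, γ t ∈ S) (hδ : ∀ t, δ t ∈ S) : pathClass γ = pathClass δ := by
  have := hS.simplyConnectedSpace
  have hx : x ∈ S := by simpa using hγ 0
  have hy : y ∈ S := by simpa using hγ 1
  let lift (α : Path x y) (h : ∀ t, α t ∈ S) : Path (⟨x, hx⟩ : S) ⟨y, hy⟩ :=
    { toFun := fun t => ⟨α t, h t⟩
      continuous_toFun := by fun_prop
      source' := by simp
      target' := by simp }
  have h := (SimplyConnectedSpace.paths_homotopic (lift γ hγ) (lift δ hδ)).map
    ⟨Subtype.val, continuous_subtype_val⟩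
  exact pathClass_eq h

end PathClass

section FiniteGeneration

variable {Y : Type*} [TopologicalSpace Y] {ι : Type*}

/-- Go from `y₀` to a fixed point of `S` and on inside `S`; the second part is unique up to homotopy
because `S` lies in a simply connected set. -/
theorem exists_transport {S : Set Y} (hS : S.Nonempty → IsPathConnected S)
    (hT : S.Nonempty → ∃ T, S ⊆ T ∧ IsSimplyConnected T) [PathConnectedSpace Y] (y₀ : Y) :
    ∃ h : ∀ y, y ∈ S → (FundamentalGroupoid.mk y₀ ⟶ FundamentalGroupoid.mk y),
      ∀ y z (hy : y ∈ S) (hz : z ∈ S) (γ : Path y z), (∀ t, γ t ∈ S) →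
        h z hz = h y hy ≫ pathClass γ := by
  by_cases hne : S.Nonempty
  · obtain ⟨c, hc⟩ := hne
    obtain ⟨T, hST, hTs⟩ := hT ⟨c, hc⟩
    have hj := fun y (hy : y ∈ S) => (hS ⟨c, hc⟩).joinedIn c hc y hy
    refine ⟨fun y hy => pathClass (PathConnectedSpace.somePath y₀ c) ≫
      pathClass (hj y hy).somePath, fun y z hy hz γ hγ => ?_⟩
    simp only [Category.assoc]
    congr 1
    rw [← pathClass_trans]
    refine pathClass_eq_of_isSimplyConnected hTs _ _ (fun t => hST ((hj z hz).somePath_mem t))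
      (fun t => hST ?_)
    rw [Path.trans_apply]
    split_ifs
    exacts [(hj y hy).somePath_mem _, hγ _]
  · exact ⟨fun y hy => absurd ⟨y, hy⟩ hne, fun y _ hy => absurd ⟨y, hy⟩ hne⟩

/-- A space with a finite closed cover in which pairwise intersections are path connected and the
stars of points are simply connected has a finitely generated fundamental group. -/
theorem fundamentalGroup_fg_of_cover [Finite ι] [PathConnectedSpace Y] (C : ι → Set Y)
    (hcl : ∀ i, IsClosed (C i)) (hcov : ∀ y, ∃ i, y ∈ C i)
    (hpc : ∀ i j, (C i ∩ C j).Nonempty → IsPathConnected (C i ∩ C j))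
    (hstar : ∀ y, IsSimplyConnected (⋃ i, ⋃ _ : y ∈ C i, C i)) (y₀ : Y) :
    Group.FG (FundamentalGroup Y y₀) := by
  have hpc1 : ∀ i, (C i).Nonempty → IsPathConnected (C i) := fun i hi => by
    simpa using hpc i i (by simpa using hi)
  choose h hh using fun i => exists_transport (hpc1 i) (fun ⟨y, hy⟩ =>
    ⟨_, Set.subset_iUnion₂_of_subset (s := C i) i hy subset_rfl, hstar y⟩) y₀
  -- The loop that goes out through `C i` and returns through `C j`. It does not depend on the point
  -- of the path-connected set `C i ∩ C j`, so finitely many loops arise.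
  let g : ∀ i j y, y ∈ C i → y ∈ C j → FundamentalGroup Y y₀ := fun i j y hi hj =>
    h i y hi ≫ Groupoid.inv (h j y hj)
  have hg : ∀ i j y z (hi : y ∈ C i) (hj : y ∈ C j) (hi' : z ∈ C i) (hj' : z ∈ C j),
      g i j y hi hj = g i j z hi' hj' := by
    intro i j y z hi hj hi' hj'
    obtain ⟨γ, hγ⟩ := (hpc i j ⟨y, hi, hj⟩).joinedIn y ⟨hi, hj⟩ z ⟨hi', hj'⟩
    simp only [g]
    rw [hh i y z hi hi' γ fun t => (hγ t).1, hh j y z hj hj' γ fun t => (hγ t).2]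
    simp
  let S : Set (FundamentalGroup Y y₀) :=
    (⋃ i, ⋃ j, {a | ∃ y hi hj, g i j y hi hj = a}) ∪ ⋃ i, {a | ∃ hi, h i y₀ hi = a}
  have hSfin : S.Finite := by
    refine (Set.finite_iUnion fun i => Set.finite_iUnion fun j => ?_).union
      (Set.finite_iUnion fun i => ?_)
    · refine Set.Subsingleton.finite ?_
      rintro _ ⟨y, hi, hj, rfl⟩ _ ⟨z, hi', hj', rfl⟩
      exact hg _ _ _ _ _ _ _ _
    · refine Set.Subsingleton.finite ?_
      rintro _ ⟨hi, rfl⟩ _ ⟨hi', rfl⟩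
      rfl
  let H : Subgroup (FundamentalGroup Y y₀) := Subgroup.closure S
  have hgH : ∀ i j y (hi : y ∈ C i) (hj : y ∈ C j), g i j y hi hj ∈ H := fun i j y hi hj =>
    Subgroup.subset_closure (Or.inl (Set.mem_iUnion₂.2 ⟨i, j, y, hi, hj, rfl⟩))
  -- Composition in the groupoid is multiplication in the opposite order.
  have hmul : ∀ (a b : FundamentalGroupoid.mk y₀ ⟶ FundamentalGroupoid.mk y₀),
      (a : FundamentalGroup Y y₀) ∈ H → (b : FundamentalGroup Y y₀) ∈ H →
        (a ≫ b : FundamentalGroup Y y₀) ∈ H := fun a b ha hb => H.mul_mem hb ha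
  have hinv : ∀ (a : FundamentalGroupoid.mk y₀ ⟶ FundamentalGroupoid.mk y₀),
      (a : FundamentalGroup Y y₀) ∈ H → (Groupoid.inv a : FundamentalGroup Y y₀) ∈ H :=
    fun a ha => H.inv_mem ha
  -- A path is good if closing it up by the transports of any pieces through its ends gives an
  -- element of `H`.
  let R : ∀ {x y : Y}, (FundamentalGroupoid.mk x ⟶ FundamentalGroupoid.mk y) → Prop :=
    fun {x y} p => ∀ i j (hi : x ∈ C i) (hj : y ∈ C j),
      (h i x hi ≫ p ≫ Groupoid.inv (h j y hj) : FundamentalGroup Y y₀) ∈ H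
  have hRcomp : ∀ {x y z : Y} (p : FundamentalGroupoid.mk x ⟶ FundamentalGroupoid.mk y)
      (q : FundamentalGroupoid.mk y ⟶ FundamentalGroupoid.mk z), R p → R q → R (p ≫ q) := by
    intro x y z p q hp hq i j hi hj
    obtain ⟨k, hk⟩ := hcov y
    have := hmul _ _ (hp i k hi hk) (hq k j hk hj)
    simpa using this
  have hRinv : ∀ {x y : Y} (p : FundamentalGroupoid.mk x ⟶ FundamentalGroupoid.mk y),
      R p → R (Groupoid.inv p) := by
    intro x y p hp i j hi hj
    have := hinv _ (hp j i hj hi)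
    simpa using this
  have hRC : ∀ {x y : Y} (γ : Path x y) (k : ι), (∀ t, γ t ∈ C k) → R (pathClass γ) := by
    intro x y γ k hγ i j hi hj
    have hx : x ∈ C k := by simpa using hγ 0
    have hy : y ∈ C k := by simpa using hγ 1
    have := hmul _ _ (hgH i k x hi hx) (hgH k j y hy hj)
    simp only [g] at this
    rw [hh k x y hx hy γ hγ] at this
    simpa using this
  have hR : ∀ {x y : Y} (γ : Path x y), R (pathClass γ) := by
    intro x y γ
    have hind : R (pathClass (γ.subpath 0 1)) := by
      -- Goodness of subpaths is transitive, so connectedness of `I` reduces it to short subpaths.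
      refine PreconnectedSpace.induction₂' (fun s t : I => R (pathClass (γ.subpath s t))) ?_ ?_ 0 1
      · intro t
        -- Near `t` the path avoids all pieces that miss `γ t`. It stays in the simply connected
        -- star of `γ t` and can be replaced by a path inside one piece.
        have hopen : IsOpen (⋃ i, ⋃ _ : γ t ∉ C i, C i)ᶜ :=
          (isClosed_iUnion_of_finite fun i => isClosed_iUnion_of_finite fun _ =>
            hcl i).isOpen_compl
        have hmem : γ ⁻¹' (⋃ i, ⋃ _ : γ t ∉ C i, C i)ᶜ ∈ 𝓝 t :=
          (hopen.preimage γ.continuous).mem_nhds (by simp)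
        have hsub : ∀ᶠ s in 𝓝 t, Set.uIcc t s ⊆ γ ⁻¹' (⋃ i, ⋃ _ : γ t ∉ C i, C i)ᶜ :=
          (tendsto_const_nhds.uIcc tendsto_id).eventually
            (eventually_smallSets_subset.2 hmem)
        filter_upwards [hsub] with s hs
        have hst : ∀ y, y ∈ (⋃ i, ⋃ _ : γ t ∉ C i, C i)ᶜ → ∃ i, γ t ∈ C i ∧ y ∈ C i := by
          intro y hy
          obtain ⟨i, hi⟩ := hcov y
          refine ⟨i, ?_, hi⟩
          by_contra hti
          exact hy (Set.mem_iUnion₂.2 ⟨i, hti, hi⟩)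
        have hmain : R (pathClass (γ.subpath t s)) := by
          obtain ⟨i, hti, hsi⟩ := hst (γ s) (hs Set.right_mem_uIcc)
          obtain ⟨δ, hδ⟩ := (hpc1 i ⟨_, hti⟩).joinedIn _ hti _ hsi
          rw [pathClass_eq_of_isSimplyConnected (hstar (γ t)) (γ.subpath t s) δ ?_ ?_]
          · exact hRC δ i hδ
          · intro r
            have hr : γ.subpath t s r ∈ γ '' Set.uIcc t s := by
              rw [← Path.range_subpath]
              exact ⟨r, rfl⟩
            obtain ⟨r', hr', he⟩ := hr
            obtain ⟨j, h1, h2⟩ := hst _ (hs hr')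
            rw [← he]
            exact Set.mem_iUnion₂.2 ⟨j, h1, h2⟩
          · exact fun r => Set.mem_iUnion₂.2 ⟨i, hti, hδ r⟩
        refine ⟨hmain, ?_⟩
        rw [← Path.symm_subpath, pathClass_symm]
        exact hRinv _ hmain
      · refine ⟨fun r s t hrs hst => ?_⟩
        have := hRcomp _ _ hrs hst
        rwa [← pathClass_trans,
          pathClass_eq ⟨Path.Homotopy.subpathTransSubpath γ r s t⟩] at this
    have hcast : ∀ (x' y' : Y) (hx : x' = x) (hy : y' = y), R (pathClass (γ.cast hx hy)) →
        R (pathClass γ) := by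
      rintro _ _ rfl rfl h
      exact h
    rw [Path.subpath_zero_one] at hind
    exact hcast _ _ _ _ hind
  refine ⟨⟨hSfin.toFinset, ?_⟩⟩
  rw [Set.Finite.coe_toFinset, eq_top_iff]
  intro p _
  obtain ⟨γ, rfl⟩ := exists_pathClass p
  obtain ⟨i, hi⟩ := hcov y₀
  have hb : (h i y₀ hi : FundamentalGroup Y y₀) ∈ H :=
    Subgroup.subset_closure (Or.inr (Set.mem_iUnion.2 ⟨i, hi, rfl⟩))
  have := hmul _ _ (hmul _ _ (hinv _ hb) (hR γ i i hi hi)) hb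
  simpa using this

/-- If `A` is path connected and embeds as a finite union of closed convex sets, then the image
of its fundamental group is finitely generated. -/
theorem pi1Image_fg_of_convex_cover {X E : Type*} [TopologicalSpace X] [NormedAddCommGroup E]
    [NormedSpace ℝ E] [Finite ι] {e : X → E} (he : IsEmbedding e) {A : Set X}
    (hA : IsPathConnected A) (D : ι → Set E) (hD : ∀ i, Convex ℝ (D i))
    (hDc : ∀ i, IsClosed (D i)) (hAD : e '' A = ⋃ i, D i) (x : A) :
    Group.FG (pi1Image A x) := by
  have : PathConnectedSpace A := isPathConnected_iff_pathConnectedSpace.1 hA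
  let e' : A → E := fun a => e a
  have he' : IsEmbedding e' := he.comp IsEmbedding.subtypeVal
  have hrange : Set.range e' = ⋃ i, D i := by
    rw [← hAD]
    ext y
    simp [e']
  have himg : ∀ S ⊆ ⋃ i, D i, e' '' (e' ⁻¹' S) = S := fun S hS => by
    rw [Set.image_preimage_eq_iff, hrange]
    exact hS
  have : Group.FG (FundamentalGroup A x) := by
    refine fundamentalGroup_fg_of_cover (fun i => e' ⁻¹' D i)
      (fun i => (hDc i).preimage he'.continuous) (fun y => ?_) (fun i j hij => ?_) (fun y => ?_) x
    · have : e' y ∈ Set.range e' := ⟨y, rfl⟩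
      rw [hrange] at this
      obtain ⟨i, hi⟩ := Set.mem_iUnion.1 this
      exact ⟨i, hi⟩
    · have hsub : D i ∩ D j ⊆ ⋃ i, D i := fun z hz => Set.mem_iUnion.2 ⟨i, hz.1⟩
      rw [← Set.preimage_inter, he'.isInducing.isPathConnected_iff, himg _ hsub]
      refine ((hD i).inter (hD j)).isPathConnected ?_
      obtain ⟨z, hz⟩ := hij
      exact ⟨e' z, hz⟩
    · have hst : (⋃ i, ⋃ _ : y ∈ e' ⁻¹' D i, e' ⁻¹' D i) =
          e' ⁻¹' (⋃ i, ⋃ _ : e' y ∈ D i, D i) := by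
        simp [Set.preimage_iUnion]
      have hsub : (⋃ i, ⋃ _ : e' y ∈ D i, D i) ⊆ ⋃ i, D i :=
        Set.iUnion_mono fun i => Set.iUnion_subset fun _ => subset_rfl
      rw [hst, ← he'.isSimplyConnected_image, himg _ hsub]
      -- A union of convex sets through one point is star convex about it, hence contractible.
      have hstar : StarConvex ℝ (e' y) (⋃ i, ⋃ _ : e' y ∈ D i, D i) :=
        starConvex_iUnion fun i => starConvex_iUnion fun hi => (hD i).starConvex hi
      have hne : (⋃ i, ⋃ _ : e' y ∈ D i, D i).Nonempty := by
        have : e' y ∈ Set.range e' := ⟨y, rfl⟩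
        rw [hrange] at this
        obtain ⟨i, hi⟩ := Set.mem_iUnion.1 this
        exact ⟨e' y, Set.mem_iUnion₂.2 ⟨i, hi, hi⟩⟩
      have := hstar.contractibleSpace hne
      exact SimplyConnectedSpace.ofContractible _
  exact Group.fg_range _

end FiniteGeneration

/-! ### Components of finite closed unions -/

section Components

variable {X : Type*} [TopologicalSpace X] {ι : Type*}

/-- The components of a finite union of closed path-connected sets are path connected and
relatively open, and are unions of some of these sets. -/
theorem connectedComponentIn_finite_iUnion [Finite ι] {A : Set X} (C : ι → Set X)
    (hcl : ∀ i, IsClosed (C i)) (hpc : ∀ i, (C i).Nonempty → IsPathConnected (C i))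
    (hA : A = ⋃ i, C i) {x : X} (hx : x ∈ A) :
    IsPathConnected (connectedComponentIn A x) ∧
      (∃ O, IsOpen O ∧ connectedComponentIn A x = A ∩ O) ∧
      connectedComponentIn A x = ⋃ i, ⋃ _ : (C i ∩ connectedComponentIn A x).Nonempty, C i := by
  set P := pathComponentIn A x with hP
  have hCA : ∀ i, C i ⊆ A := fun i => hA ▸ Set.subset_iUnion C i
  have hPA : P ⊆ A := pathComponentIn_subset
  have hin : ∀ i, (C i ∩ P).Nonempty → C i ⊆ P := by
    rintro i ⟨y, hy, hyP⟩ z hz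
    exact JoinedIn.trans hyP (((hpc i ⟨y, hy⟩).joinedIn y hy z hz).mono (hCA i))
  have hPeq : P = ⋃ i, ⋃ _ : (C i ∩ P).Nonempty, C i := by
    refine Set.Subset.antisymm (fun y hy => ?_) (Set.iUnion₂_subset hin)
    obtain ⟨i, hi⟩ := Set.mem_iUnion.1 (hA ▸ hPA hy : y ∈ ⋃ i, C i)
    exact Set.mem_iUnion₂.2 ⟨i, ⟨y, hi, hy⟩, hi⟩
  -- Each piece lies in the path component `P` or misses it. So `P` and `Q` are disjoint closed sets
  -- covering `A`, and a connected subset through `x` stays in `P`.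
  set Q : Set X := ⋃ i, ⋃ _ : ¬ (C i ∩ P).Nonempty, C i with hQ
  have hPcl : IsClosed P := by
    rw [hPeq]
    exact isClosed_iUnion_of_finite fun i => isClosed_iUnion_of_finite fun _ => hcl i
  have hQcl : IsClosed Q :=
    isClosed_iUnion_of_finite fun i => isClosed_iUnion_of_finite fun _ => hcl i
  have hAPQ : A ⊆ P ∪ Q := by
    intro y hy
    obtain ⟨i, hi⟩ := Set.mem_iUnion.1 (hA ▸ hy : y ∈ ⋃ i, C i)
    by_cases h : (C i ∩ P).Nonempty
    · exact Or.inl (hin i h hi)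
    · exact Or.inr (Set.mem_iUnion₂.2 ⟨i, h, hi⟩)
  have hdisj : ∀ y ∈ P, y ∉ Q := by
    intro y hyP hyQ
    obtain ⟨i, h, hi⟩ := Set.mem_iUnion₂.1 hyQ
    exact h ⟨y, hi, hyP⟩
  have hcomp : connectedComponentIn A x = P := by
    refine Set.Subset.antisymm ?_ ?_
    · have hempty : connectedComponentIn A x ∩ (P ∩ Q) = ∅ :=
        Set.eq_empty_of_forall_notMem fun y hy => hdisj y hy.2.1 hy.2.2
      rcases isPreconnected_iff_subset_of_disjoint_closed.1
        (isPreconnected_connectedComponentIn (x := x) (F := A)) P Q hPcl hQcl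
        ((connectedComponentIn_subset A x).trans hAPQ) hempty with h | h
      · exact h
      · exact absurd (h (mem_connectedComponentIn hx)) (hdisj x (mem_pathComponentIn_self hx))
    · have hconn := (isPathConnected_pathComponentIn hx).isConnected.isPreconnected
      exact hconn.subset_connectedComponentIn (mem_pathComponentIn_self hx) hPA
  rw [hcomp]
  refine ⟨isPathConnected_pathComponentIn hx, ⟨Qᶜ, hQcl.isOpen_compl, ?_⟩, hPeq⟩
  refine Set.Subset.antisymm (fun y hy => ⟨hPA hy, hdisj y hy⟩) ?_
  rintro y ⟨hyA, hyQ⟩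
  exact (hAPQ hyA).resolve_right hyQ

end Components

/-! ### Deformations and images of fundamental groups -/

section Deformation

variable {X : Type*} [TopologicalSpace X]

theorem mem_pi1Image_iff {A : Set X} {x : A} {p : FundamentalGroup X (x : X)} :
    p ∈ pi1Image A x ↔ ∃ γ : Path (x : X) x, (∀ t, γ t ∈ A) ∧ pathClass γ = p := by
  constructor
  · rintro ⟨q, rfl⟩
    obtain ⟨γ, rfl⟩ := exists_pathClass q
    exact ⟨γ.map continuous_subtype_val, fun t => (γ t).2, rfl⟩
  · rintro ⟨γ, hγ, rfl⟩
    let γ' : Path x x :=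
      { toFun := fun t => ⟨γ t, hγ t⟩
        continuous_toFun := by fun_prop
        source' := by simp
        target' := by simp }
    exact ⟨pathClass γ', rfl⟩

theorem pi1Image_mono {A B : Set X} (hAB : A ⊆ B) {x : X} (hxA : x ∈ A) (hxB : x ∈ B) :
    pi1Image A ⟨x, hxA⟩ ≤ pi1Image B ⟨x, hxB⟩ := by
  intro p hp
  obtain ⟨γ, hγ, rfl⟩ := mem_pi1Image_iff.1 hp
  exact mem_pi1Image_iff.2 ⟨γ, fun t => hAB (hγ t), rfl⟩

/-- The two boundary paths of a square are homotopic. -/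
theorem pathClass_square (Γ : C(I × I, X)) {a b c d : X} (p : Path a b) (q : Path b d)
    (p' : Path a c) (q' : Path c d) (hp : ∀ t, p t = Γ (0, t)) (hq : ∀ t, q t = Γ (t, 1))
    (hp' : ∀ t, p' t = Γ (t, 0)) (hq' : ∀ t, q' t = Γ (1, t)) :
    pathClass p ≫ pathClass q = pathClass p' ≫ pathClass q' := by
  obtain rfl : a = Γ (0, 0) := by rw [← hp, p.source]
  obtain rfl : b = Γ (0, 1) := by rw [← hp, p.target]
  obtain rfl : c = Γ (1, 0) := by rw [← hp', p'.target]
  obtain rfl : d = Γ (1, 1) := by rw [← hq', q'.target]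
  let r : Path ((0, 0) : I × I) (0, 1) := ⟨⟨fun t => (0, t), by fun_prop⟩, rfl, rfl⟩
  let s : Path ((0, 1) : I × I) (1, 1) := ⟨⟨fun t => (t, 1), by fun_prop⟩, rfl, rfl⟩
  let r' : Path ((0, 0) : I × I) (1, 0) := ⟨⟨fun t => (t, 0), by fun_prop⟩, rfl, rfl⟩
  let s' : Path ((1, 0) : I × I) (1, 1) := ⟨⟨fun t => (1, t), by fun_prop⟩, rfl, rfl⟩
  obtain rfl : p = r.map Γ.continuous := by ext t; exact hp t
  obtain rfl : q = s.map Γ.continuous := by ext t; exact hq t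
  obtain rfl : p' = r'.map Γ.continuous := by ext t; exact hp' t
  obtain rfl : q' = s'.map Γ.continuous := by ext t; exact hq' t
  have hI : ContractibleSpace I := (convex_Icc (0 : ℝ) 1).contractibleSpace ⟨0, by simp⟩
  have h := (SimplyConnectedSpace.paths_homotopic (r.trans s) (r'.trans s')).map Γ
  rw [Path.map_trans, Path.map_trans] at h
  rw [← pathClass_trans, ← pathClass_trans]
  exact pathClass_eq h

/-- A homotopy that moves `U` within itself into a subset `F` of `U` identifies the images of the
fundamental groups. -/
theorem pi1Image_equiv_of_deformation {U F : Set X} (hFU : F ⊆ U) (H : C(I × U, X))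
    (h0 : ∀ u, H (0, u) = u) (h1 : ∀ u, H (1, u) ∈ F) (hU : ∀ t u, H (t, u) ∈ U) (x : U) :
    Nonempty (pi1Image F ⟨H (1, x), h1 x⟩ ≃* pi1Image U x) := by
  -- The track of the base point; conjugation by it is the required isomorphism.
  let β : Path (x : X) (H (1, x)) :=
    { toFun := fun t => H (t, x)
      continuous_toFun := by fun_prop
      source' := h0 x
      target' := rfl }
  let e := FundamentalGroup.fundamentalGroupMulEquivOfPath β
  have he : ∀ p : FundamentalGroupoid.mk (x : X) ⟶ FundamentalGroupoid.mk (x : X),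
      e p = Groupoid.inv (pathClass β) ≫ p ≫ pathClass β := fun p => rfl
  have hmap : (pi1Image U x).map e.toMonoidHom = pi1Image F ⟨H (1, x), h1 x⟩ := by
    refine le_antisymm ?_ ?_
    · rintro _ ⟨p, hp, rfl⟩
      obtain ⟨γ, hγ, rfl⟩ := mem_pi1Image_iff.1 hp
      let Γ : C(I × I, X) := ⟨fun z => H (z.1, ⟨γ z.2, hγ z.2⟩), by fun_prop⟩
      let γ' : Path (H (1, x)) (H (1, x)) :=
        { toFun := fun t => H (1, ⟨γ t, hγ t⟩)
          continuous_toFun := by fun_prop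
          source' := by simp
          target' := by simp }
      refine mem_pi1Image_iff.2 ⟨γ', fun t => h1 _, ?_⟩
      -- The square swept out by the deformed loop shows that the end loop `γ'` is the conjugate of
      -- `γ` by `β`.
      have hsq := pathClass_square Γ γ β β γ' (fun t => (h0 ⟨γ t, hγ t⟩).symm)
        (fun t => by simp [Γ, β])
        (fun t => by simp [Γ, β]) (fun t => rfl)
      change pathClass γ' = Groupoid.inv (pathClass β) ≫ pathClass γ ≫ pathClass β
      rw [hsq]
      simp
    · intro p hp
      obtain ⟨δ, hδ, rfl⟩ := mem_pi1Image_iff.1 hp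
      refine ⟨pathClass ((β.trans δ).trans β.symm), mem_pi1Image_iff.2 ⟨_, ?_, rfl⟩, ?_⟩
      · have hβ : ∀ t, β t ∈ U := fun t => hU t x
        intro t
        rw [Path.trans_apply]
        split_ifs
        · rw [Path.trans_apply]
          split_ifs
          exacts [hβ _, hFU (hδ _)]
        · exact hβ _
      · change Groupoid.inv (pathClass β) ≫ ((pathClass β ≫ pathClass δ) ≫
          Groupoid.inv (pathClass β)) ≫ pathClass β = pathClass δ
        simp
  exact ⟨(MulEquiv.subgroupCongr hmap.symm).trans (e.subgroupMap (pi1Image U x)).symm⟩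

end Deformation

/-! ### Simplicial maps as push-forward of weights -/

section SimplicialMaps

variable {E F : Type*}

theorem mapDomain_apply_eq_sum [DecidableEq F] (f : E → F) {w : E →₀ ℝ} {s : Finset E}
    (hs : w.support ⊆ s) (v : F) :
    w.mapDomain f v = ∑ u ∈ s, if f u = v then w u else 0 := by
  rw [Finsupp.mapDomain, Finsupp.sum_of_support_subset _ hs _ (by simp), Finsupp.finsetSum_apply]
  exact Finset.sum_congr rfl fun u _ => Finsupp.single_apply

theorem totalMass_mapDomain (f : E → F) (w : E →₀ ℝ) :
    totalMass (w.mapDomain f) = totalMass w := by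
  rw [totalMass, Finsupp.linearCombination_mapDomain]
  rfl

theorem mapDomain_nonneg (f : E → F) {w : E →₀ ℝ} (hw : ∀ v, 0 ≤ w v) (v : F) :
    0 ≤ w.mapDomain f v := by
  classical
  rw [mapDomain_apply_eq_sum f subset_rfl]
  exact Finset.sum_nonneg fun u _ => by split_ifs; exacts [hw u, le_rfl]

theorem mapDomain_pos_iff (f : E → F) {w : E →₀ ℝ} (hw : ∀ v, 0 ≤ w v) {v : F} :
    0 < w.mapDomain f v ↔ ∃ u ∈ w.support, f u = v := by
  classical
  rw [mapDomain_apply_eq_sum f subset_rfl, Finset.sum_pos_iff_of_nonneg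
    (fun u _ => by split_ifs; exacts [hw u, le_rfl])]
  refine exists_congr fun u => and_congr_right fun hu => ?_
  split_ifs with h
  · simpa [h] using lt_of_le_of_ne (hw u) (Finsupp.mem_support_iff.1 hu).symm
  · simp [h]

theorem isBary_mapDomain {𝓕 : Set (Finset E)} [AddCommGroup F] [Module ℝ F]
    {L : SimplicialComplex ℝ F} {f : E → F} {w : E →₀ ℝ} (hw : IsBary 𝓕 w) {t : Finset F}
    (ht : t ∈ L.faces) (hft : ∀ v ∈ w.support, f v ∈ t) : IsBary L.faces (w.mapDomain f) := by
  classical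
  have hmass : totalMass (w.mapDomain f) = 1 := by rw [totalMass_mapDomain, hw.mass]
  refine ⟨mapDomain_nonneg f hw.nonneg, L.down_closed ht ?_ ?_, hmass⟩
  · refine Finsupp.mapDomain_support.trans (Finset.image_subset_iff.2 hft)
  · rw [Finsupp.support_nonempty_iff]
    intro h
    simp [h] at hmass

theorem weightedPoint_mapDomain [AddCommGroup F] [Module ℝ F] (f : E → F) (w : E →₀ ℝ) :
    weightedPoint (w.mapDomain f) = ∑ v ∈ w.support, w v • f v := by
  rw [weightedPoint, Finsupp.linearCombination_mapDomain, Finsupp.linearCombination_apply]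
  rfl

variable [AddCommGroup E] [Module ℝ E] [AddCommGroup F] [Module ℝ F]
  {K : SimplicialComplex ℝ E} {L : SimplicialComplex ℝ F} {f : E → F}

theorem IsSimplicialMap.isBary (hf : IsSimplicialMap K L f) {w : E →₀ ℝ}
    (hw : IsBary K.faces w) : IsBary L.faces (w.mapDomain f) := by
  obtain ⟨⟨t, ht, hts⟩, -⟩ := hf _ hw.support_mem
  refine isBary_mapDomain hw ht fun v hv => ?_
  rw [← Finset.mem_coe, hts]
  exact ⟨v, hv, rfl⟩

theorem IsSimplicialMap.apply_weightedPoint (hf : IsSimplicialMap K L f) {w : E →₀ ℝ}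
    (hw : IsBary K.faces w) : f (weightedPoint w) = weightedPoint (w.mapDomain f) := by
  have h := (hf _ hw.support_mem).2 w (fun v _ => hw.nonneg v)
    (by rw [← totalMass_eq_sum subset_rfl, hw.mass])
  rw [weightedPoint_mapDomain, ← h, weightedPoint_eq_sum subset_rfl]

theorem IsSimplicialMap.bary_apply (hf : IsSimplicialMap K L f) {x : E} (hx : x ∈ K.space) :
    L.bary (f x) = (K.bary x).mapDomain f := by
  have hw := SimplicialComplex.isBary_bary hx
  conv_lhs => rw [← SimplicialComplex.weightedPoint_bary hx, hf.apply_weightedPoint hw]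
  exact SimplicialComplex.bary_weightedPoint (hf.isBary hw)

end SimplicialMaps

section Indicator

variable {E : Type*} {s : Finset E}

theorem totalMass_indicator (w : E → ℝ) :
    totalMass (Finsupp.indicator s fun v _ => w v) = ∑ v ∈ s, w v := by
  rw [totalMass_eq_sum (Finsupp.support_indicator_subset s _)]
  exact Finset.sum_congr rfl fun v hv => Finsupp.indicator_of_mem hv _

theorem indicator_nonneg {w : E → ℝ} (hw : ∀ v ∈ s, 0 ≤ w v) (v : E) :
    0 ≤ Finsupp.indicator s (fun v _ => w v) v := by
  by_cases hv : v ∈ s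
  · rw [Finsupp.indicator_of_mem hv]
    exact hw v hv
  · rw [Finsupp.indicator_of_notMem hv]

theorem isBary_indicator {K : Set (Finset E)} (hK : ∀ t ⊆ s, t.Nonempty → t ∈ K) {w : E → ℝ}
    (hw : ∀ v ∈ s, 0 ≤ w v) (hw1 : ∑ v ∈ s, w v = 1) :
    IsBary K (Finsupp.indicator s fun v _ => w v) := by
  have hmass : totalMass (Finsupp.indicator s fun v _ => w v) = 1 := by
    rw [totalMass_indicator, hw1]
  refine ⟨indicator_nonneg hw, hK _ (Finsupp.support_indicator_subset s _) ?_, hmass⟩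
  rw [Finsupp.support_nonempty_iff]
  intro h
  simp [h] at hmass

end Indicator

/-! ### The image complex on basis vectors -/

section Nerve

variable {E : Type*} [AddCommGroup E] [Module ℝ E] {N : ℕ}

/-- The basis vectors of Euclidean space. -/
def basisVector (j : Fin N) : EuclideanSpace ℝ (Fin N) := EuclideanSpace.single j 1

theorem basisVector_injective : Function.Injective (basisVector (N := N)) := by
  intro i j h
  by_contra hij
  have := congrArg (fun x : EuclideanSpace ℝ (Fin N) => x i) h
  simp [basisVector, hij] at this

/-- Weights on basis vectors are the coordinates of the point; this gives the uniqueness that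
`complexOfUnique` asks for. -/
theorem weightedPoint_basisVector {w : EuclideanSpace ℝ (Fin N) →₀ ℝ}
    (hw : ∀ v ∈ w.support, ∃ j, basisVector j = v) (j : Fin N) :
    weightedPoint w j = w (basisVector j) := by
  classical
  rw [weightedPoint_eq_sum subset_rfl, WithLp.ofLp_sum, Finset.sum_apply]
  rw [Finset.sum_eq_single (basisVector j)]
  · simp [basisVector]
  · intro v hv hne
    obtain ⟨l, rfl⟩ := hw v hv
    have : l ≠ j := fun h => hne (h ▸ rfl)
    simp [basisVector, this.symm]
  · intro h
    rw [Finsupp.notMem_support_iff.1 h]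
    simp

/-- The images of the simplices of `K` when the vertices are mapped to basis vectors. -/
def nerveImageFaces (K : SimplicialComplex ℝ E) (i : E → Fin N) :
    Set (Finset (EuclideanSpace ℝ (Fin N))) :=
  {t | ∃ s ∈ K.faces, (t : Set (EuclideanSpace ℝ (Fin N))) =
    (fun v => basisVector (i v)) '' (s : Set E)}

/-- The complex spanned by the images of the simplices of `K` when the vertices are mapped to basis
vectors of Euclidean space. -/
def nerveImage (K : SimplicialComplex ℝ E) (i : E → Fin N) :
    SimplicialComplex ℝ (EuclideanSpace ℝ (Fin N)) :=
  complexOfUnique (nerveImageFaces K i)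
    (by
      rintro t ⟨s, hs, h⟩
      rw [← Finset.coe_nonempty, h]
      exact Set.Nonempty.image _ (Finset.coe_nonempty.2 (K.nonempty_of_mem_faces hs)))
    (by
      classical
      rintro t ⟨s, hs, h⟩ t' ht' hne
      have himg : (t' : Set _) = (fun v => basisVector (i v)) ''
          (↑(s.filter fun v => basisVector (i v) ∈ t') : Set E) := by
        ext y
        simp only [Finset.mem_coe, Set.mem_image, Finset.mem_filter]
        constructor
        · intro hy
          have : y ∈ (t : Set _) := ht' hy
          rw [h] at this
          obtain ⟨v, hv, rfl⟩ := this
          exact ⟨v, ⟨hv, hy⟩, rfl⟩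
        · rintro ⟨v, ⟨-, hv⟩, rfl⟩
          exact hv
      refine ⟨_, K.down_closed hs (Finset.filter_subset _ s) ?_, himg⟩
      rw [← Finset.coe_nonempty, himg, Set.image_nonempty, Finset.coe_nonempty] at hne
      exact hne)
    (by
      have hb : ∀ w : EuclideanSpace ℝ (Fin N) →₀ ℝ, IsBary (nerveImageFaces K i) w →
          ∀ v ∈ w.support, ∃ j, basisVector j = v := by
        intro w hw v hv
        obtain ⟨s, -, h⟩ := hw.support_mem
        rw [← Finset.mem_coe, h] at hv
        obtain ⟨u, -, rfl⟩ := hv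
        exact ⟨_, rfl⟩
      intro w w' hw hw' h
      ext v
      by_cases hv : ∃ j, basisVector j = v
      · obtain ⟨j, rfl⟩ := hv
        rw [← weightedPoint_basisVector (hb w hw), ← weightedPoint_basisVector (hb w' hw'), h]
      · rw [Finsupp.notMem_support_iff.1 fun h => hv (hb w hw v h),
          Finsupp.notMem_support_iff.1 fun h => hv (hb w' hw' v h)])

/-- The map of `K` onto `nerveImage K i` that is linear on simplices. -/
def nerveImageMap (K : SimplicialComplex ℝ E) (i : E → Fin N) (x : E) : EuclideanSpace ℝ (Fin N) :=
  weightedPoint ((K.bary x).mapDomain fun v => basisVector (i v))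

variable {K : SimplicialComplex ℝ E} {i : E → Fin N}

theorem isBary_nerveImageMap {w : E →₀ ℝ} (hw : IsBary K.faces w) :
    IsBary (nerveImage K i).faces (w.mapDomain fun v => basisVector (i v)) := by
  classical
  refine isBary_mapDomain hw (t := w.support.image fun v => basisVector (i v))
    ⟨_, hw.support_mem, by simp⟩ fun v hv => Finset.mem_image_of_mem _ hv

theorem nerveImageMap_vertex {v : E} (hv : {v} ∈ K.faces) :
    nerveImageMap K i v = basisVector (i v) := by
  rw [nerveImageMap, SimplicialComplex.bary_vertex hv, Finsupp.mapDomain_single,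
    weightedPoint_single, one_smul]

theorem isSimplicialMap_nerveImageMap : IsSimplicialMap K (nerveImage K i) (nerveImageMap K i) := by
  classical
  intro s hs
  have hvert : ∀ v ∈ s, nerveImageMap K i v = basisVector (i v) := fun v hv =>
    nerveImageMap_vertex (SimplicialComplex.singleton_mem hs hv)
  refine ⟨⟨s.image fun v => basisVector (i v), ⟨s, hs, by simp⟩, ?_⟩, fun w hw hw1 => ?_⟩
  · rw [Finset.coe_image]
    exact Set.image_congr fun v hv => (hvert v hv).symm
  · have hb : IsBary K.faces (Finsupp.indicator s fun v _ => w v) :=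
      isBary_indicator (fun t ht hne => K.down_closed hs ht hne) hw hw1
    have hsub := Finsupp.support_indicator_subset s fun v _ => w v
    have hpt : ∑ v ∈ s, w v • v = weightedPoint (Finsupp.indicator s fun v _ => w v) := by
      rw [weightedPoint_eq_sum hsub]
      exact Finset.sum_congr rfl fun v hv => by rw [Finsupp.indicator_of_mem hv]
    rw [hpt, nerveImageMap, SimplicialComplex.bary_weightedPoint hb, weightedPoint_mapDomain,
      Finset.sum_subset hsub fun v _ hv => by
        rw [Finsupp.notMem_support_iff.1 hv, zero_smul]]
    exact Finset.sum_congr rfl fun v hv => by rw [Finsupp.indicator_of_mem hv, hvert v hv]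

theorem image_nerveImageMap : nerveImageMap K i '' K.space = (nerveImage K i).space := by
  classical
  refine Set.Subset.antisymm ?_ ?_
  · rintro _ ⟨x, hx, rfl⟩
    exact SimplicialComplex.weightedPoint_mem_space
      (isBary_nerveImageMap (SimplicialComplex.isBary_bary hx))
  · intro p hp
    obtain ⟨hw, hwp⟩ := SimplicialComplex.bary_spec hp
    set w := (nerveImage K i).bary p
    obtain ⟨s, hs, hws⟩ := hw.support_mem
    have hsec : ∀ y ∈ w.support, ∃ v ∈ s, basisVector (i v) = y := by
      intro y hy
      rw [← Finset.mem_coe, hws] at hy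
      exact hy
    -- A section on vertices with values in the single simplex `s`, so that the lifted weights are
    -- again carried by a simplex.
    choose! g hgs hg using hsec
    have hb : IsBary K.faces (w.mapDomain g) := isBary_mapDomain hw hs hgs
    refine ⟨weightedPoint (w.mapDomain g), SimplicialComplex.weightedPoint_mem_space hb, ?_⟩
    rw [nerveImageMap, SimplicialComplex.bary_weightedPoint hb, ← Finsupp.mapDomain_comp,
      Finsupp.mapDomain_congr (f := (fun v => basisVector (i v)) ∘ g) (g := id) hg,
      Finsupp.mapDomain_id, hwp]

end Nerve

/-! ### From a cover to a collapse -/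

section CoverToCollapse

variable {E : Type u} [NormedAddCommGroup E] [NormedSpace ℝ E] {K : SimplicialComplex ℝ E}

theorem Geometry.SimplicialComplex.continuous_bary_apply_of_subset (hK : K.faces.Finite)
    {A : Set E} (hA : A ⊆ K.space) (v : E) : Continuous fun x : A => K.bary x v :=
  (SimplicialComplex.continuous_bary_apply hK v).comp (continuous_inclusion hA)

/-- In a complex with edges of length at most `r`, open stars of vertices have radius at most `r`. -/
theorem dist_le_of_bary_pos {r : ℝ} (hK : ∀ s ∈ K.faces, ∀ x ∈ s, ∀ y ∈ s, dist x y ≤ r) {x v : E}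
    (hx : x ∈ K.space) (hv : v ∈ (K.bary x).support) : dist x v ≤ r := by
  obtain ⟨hb, hbx⟩ := SimplicialComplex.bary_spec hx
  have h := weightedPoint_mem_convexHull hb.nonneg subset_rfl hb.mass
  rw [hbx] at h
  have hsub : ((K.bary x).support : Set E) ⊆ Metric.closedBall v r := fun y hy =>
    hK _ hb.support_mem y hy v hv
  exact convexHull_min hsub (convex_closedBall v r) h

theorem bary_vertex_mem_space {x v : E} (hx : x ∈ K.space) (hv : v ∈ (K.bary x).support) :
    v ∈ K.space :=
  K.subset_space (SimplicialComplex.isBary_bary hx).support_mem hv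

/-- The fibre of a simplicial map over `p` meets each simplex in a closed convex set. -/
theorem convex_fiber_inter_face {F : Type*} [AddCommGroup F] [Module ℝ F]
    {L : SimplicialComplex ℝ F} {f : E → F} (hf : IsSimplicialMap K L f) (p : F) {s : Finset E}
    (hs : s ∈ K.faces) : Convex ℝ {y | y ∈ convexHull ℝ (s : Set E) ∧ f y = p} := by
  rintro x ⟨hx, hxp⟩ y ⟨hy, hyp⟩ a b ha hb hab
  refine ⟨convex_convexHull ℝ _ hx hy ha hb hab, ?_⟩
  obtain ⟨w, hw, hws, rfl⟩ := SimplicialComplex.exists_isBary_of_mem_face hs hx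
  obtain ⟨w', hw', hws', rfl⟩ := SimplicialComplex.exists_isBary_of_mem_face hs hy
  have hmass : totalMass (a • w + b • w') = 1 := by
    rw [map_add, map_smul, map_smul, hw.mass, hw'.mass, smul_eq_mul, smul_eq_mul, mul_one,
      mul_one, hab]
  have hbary : IsBary K.faces (a • w + b • w') := by
    classical
    refine ⟨fun v => ?_, K.down_closed hs ?_ ?_, hmass⟩
    · have := hw.nonneg v
      have := hw'.nonneg v
      simp only [Finsupp.add_apply, Finsupp.smul_apply, smul_eq_mul]
      positivity
    · exact Finsupp.support_add.trans (Finset.union_subset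
        (Finsupp.support_smul.trans hws) (Finsupp.support_smul.trans hws'))
    · rw [Finsupp.support_nonempty_iff]
      intro h
      simp [h] at hmass
  have h1 := hf.apply_weightedPoint hbary
  rw [map_add, map_smul, map_smul] at h1
  rw [h1, Finsupp.mapDomain_add, Finsupp.mapDomain_smul, Finsupp.mapDomain_smul, map_add, map_smul,
    map_smul, ← hf.apply_weightedPoint hw, ← hf.apply_weightedPoint hw', hxp, hyp, ← add_smul,
    hab, one_smul]

theorem continuous_of_isSimplicialMap {F : Type*} [NormedAddCommGroup F] [NormedSpace ℝ F]
    {L : SimplicialComplex ℝ F} {f : E → F} (hK : K.faces.Finite) (hf : IsSimplicialMap K L f)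
    {A : Set E} (hA : A ⊆ K.space) : Continuous fun x : A => f x := by
  have h : (fun x : A => f x) = fun x : A => ∑ v ∈ K.vertexFinset, K.bary x v • f v := by
    funext x
    have hb := SimplicialComplex.bary_spec (hA x.2)
    conv_lhs => rw [← hb.2, hf.apply_weightedPoint hb.1, weightedPoint_mapDomain]
    exact Finset.sum_subset (SimplicialComplex.subset_vertexFinset hK hb.1.support_mem)
      fun v _ hv => by rw [Finsupp.notMem_support_iff.1 hv, zero_smul]
  rw [h]
  exact continuous_finsetSum _ fun v _ =>
    (SimplicialComplex.continuous_bary_apply_of_subset hK hA v).smul continuous_const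

/-- The pieces of a fibre of a map of a polyhedron that lie in the simplices. -/
def fiberPiece {F : Type*} (K : SimplicialComplex ℝ E) (f : E → F) (p : F) (X : Set E)
    (s : K.faces) : Set X :=
  {y | (y : E) ∈ convexHull ℝ ((s : Finset E) : Set E) ∧ f y = p}

theorem image_fiberPiece {F : Type*} {f : E → F} {X : Set E}
    (hX : K.space = X) (p : F) (s : K.faces) :
    Subtype.val '' fiberPiece K f p X s =
      {y | y ∈ convexHull ℝ ((s : Finset E) : Set E) ∧ f y = p} := by
  ext y
  constructor
  · rintro ⟨z, hz, rfl⟩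
    exact hz
  · intro hy
    exact ⟨⟨y, hX ▸ K.convexHull_subset_space s.2 hy.1⟩, hy, rfl⟩

theorem fiber_eq_iUnion_fiberPiece {F : Type*} {f : E → F} {X : Set E}
    (hX : K.space = X) (p : F) :
    {y : X | f y = p} = ⋃ s, fiberPiece K f p X s := by
  ext y
  simp only [Set.mem_iUnion, fiberPiece, Set.mem_ofPred_eq, Subtype.exists, exists_and_right]
  refine ⟨fun h => ⟨?_, h⟩, fun h => h.2⟩
  obtain ⟨s, hs, hys⟩ := SimplicialComplex.mem_space_iff.1 (hX ▸ y.2 : (y : E) ∈ K.space)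
  exact ⟨s, hs, hys⟩

section Fibers

variable {F : Type*} [NormedAddCommGroup F] [NormedSpace ℝ F] {L : SimplicialComplex ℝ F}
  {f : E → F} {X : Set E}

theorem isClosed_fiberPiece (hK : K.faces.Finite) (hf : IsSimplicialMap K L f)
    (hX : K.space = X) (p : F) (s : K.faces) : IsClosed (fiberPiece K f p X s) := by
  refine IsClosed.inter ?_ ?_
  · exact ((s : Finset E).finite_toSet.isCompact_convexHull (𝕜 := ℝ)).isClosed.preimage
      continuous_subtype_val
  · exact isClosed_eq (continuous_of_isSimplicialMap hK hf hX.ge) continuous_const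

theorem isPathConnected_fiberPiece (hf : IsSimplicialMap K L f)
    (hX : K.space = X) (p : F) (s : K.faces) (hne : (fiberPiece K f p X s).Nonempty) :
    IsPathConnected (fiberPiece K f p X s) := by
  rw [IsInducing.subtypeVal.isPathConnected_iff]
  have hc := convex_fiber_inter_face hf p s.2
  rw [← image_fiberPiece hX] at hc
  exact hc.isPathConnected (hne.image _)

theorem connectedComponentIn_fiber (hK : K.faces.Finite) (hf : IsSimplicialMap K L f)
    (hX : K.space = X) {p : F} {x : X} (hx : f x = p) :
    IsPathConnected (connectedComponentIn {y : X | f y = p} x) ∧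
      (∃ O, IsOpen O ∧ connectedComponentIn {y : X | f y = p} x = {y : X | f y = p} ∩ O) ∧
      connectedComponentIn {y : X | f y = p} x =
        ⋃ s, ⋃ _ : (fiberPiece K f p X s ∩ connectedComponentIn {y : X | f y = p} x).Nonempty,
          fiberPiece K f p X s := by
  have : Finite K.faces := hK
  exact connectedComponentIn_finite_iUnion (fiberPiece K f p X)
    (isClosed_fiberPiece hK hf hX p) (isPathConnected_fiberPiece hf hX p)
    (fiber_eq_iUnion_fiberPiece hX p) hx

/-- Components of fibres of simplicial maps have finitely generated fundamental groups. -/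
theorem pi1Image_fiber_fg (hK : K.faces.Finite) (hf : IsSimplicialMap K L f)
    (hX : K.space = X) {p : F} {x : X} (hx : f x = p) :
    Group.FG (pi1Image (connectedComponentIn {y : X | f y = p} x)
      ⟨x, mem_connectedComponentIn hx⟩) := by
  have : Finite K.faces := hK
  obtain ⟨h1, -, h3⟩ := connectedComponentIn_fiber hK hf hX hx
  refine pi1Image_fg_of_convex_cover (ι := {s : K.faces // (fiberPiece K f p X s ∩
    connectedComponentIn {y : X | f y = p} x).Nonempty}) IsEmbedding.subtypeVal h1
    (fun s => Subtype.val '' fiberPiece K f p X s) (fun s => ?_) (fun s => ?_) ?_ _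
  · rw [image_fiberPiece hX]
    exact convex_fiber_inter_face hf p s.1.2
  · have hc : CompactSpace X :=
      isCompact_iff_compactSpace.1 (hX ▸ SimplicialComplex.isCompact_space hK)
    exact ((isClosed_fiberPiece hK hf hX p s).isCompact.image continuous_subtype_val).isClosed
  · conv_lhs => rw [h3]
    simp only [Set.image_iUnion, Set.iUnion_subtype]

end Fibers

theorem fiberCollapsing_of_hasOpenCover (hfin : K.faces.Finite) (hne : K.space.Nonempty) (k : ℕ)
    (Q : ∀ (G : Type u) [Group G], Prop)
    (hQ : ∀ (G H : Type u) [Group G] [Group H] (f : H →* G), Function.Injective f →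
      Group.FG H → Q G → Q H)
    (hcov : HasOpenCoverOfMultiplicity K.space k Q) : FiberCollapsing K k Q := by
  classical
  obtain ⟨𝒰, hU, hmult, h𝒰⟩ := hcov
  have hcomp : CompactSpace K.space :=
    isCompact_iff_compactSpace.1 (SimplicialComplex.isCompact_space hfin)
  obtain ⟨δ, hδ, hball⟩ := lebesgue_number_lemma_of_metric_sUnion (isCompact_univ (X := K.space))
    (fun U hU => (h𝒰 U hU).1) hU.ge
  obtain ⟨K', hK', hmesh⟩ := exists_subdivision_dist_le hfin (half_pos hδ)
  have hsp := hK'.space_eq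
  have hUex : ∀ v : E, ∃ U : Set K.space, ∀ hv : v ∈ K.space,
      U ∈ 𝒰 ∧ Metric.ball (⟨v, hv⟩ : K.space) δ ⊆ U := by
    intro v
    by_cases hv : v ∈ K.space
    · obtain ⟨U, h1, h2⟩ := hball ⟨v, hv⟩ trivial
      exact ⟨U, fun _ => ⟨h1, h2⟩⟩
    · exact ⟨∅, fun h => absurd h hv⟩
  choose U hUv using hUex
  have hx' : ∀ x : K.space, (x : E) ∈ K'.space := fun x => hsp.ge x.2
  have hsupp : ∀ (x : K.space) (v : E), v ∈ (K'.bary x).support → U v ∈ 𝒰 ∧ x ∈ U v := by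
    intro x v hv
    have hvs : v ∈ K.space := hsp ▸ bary_vertex_mem_space (hx' x) hv
    refine ⟨(hUv v hvs).1, (hUv v hvs).2 ?_⟩
    have := dist_le_of_bary_pos hmesh (hx' x) hv
    rw [Metric.mem_ball, Subtype.dist_eq]
    exact lt_of_le_of_lt this (half_lt_self hδ)
  -- Vertices of the target correspond to chosen sets, not to vertices of `K'`: multiplicity bounds
  -- the number of distinct sets at a point only.
  let 𝒯 : Finset (Set K.space) := K'.vertexFinset.image U
  have h𝒯 : ∀ s ∈ K'.faces, ∀ v ∈ s, U v ∈ 𝒯 := fun s hs v hv =>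
    Finset.mem_image_of_mem _ (SimplicialComplex.subset_vertexFinset hK'.finite hs hv)
  obtain ⟨x₀, hx₀⟩ := hne
  obtain ⟨v₀, hv₀⟩ := (SimplicialComplex.isBary_bary (hx' ⟨x₀, hx₀⟩)).support_nonempty
  let e : 𝒯 ≃ Fin 𝒯.card := 𝒯.equivFin
  -- The value outside `𝒯` is arbitrary; the vertex `v₀` shows that one exists.
  let c : Set K.space → Fin 𝒯.card := fun V => if h : V ∈ 𝒯 then e ⟨V, h⟩ else
    e ⟨U v₀, h𝒯 _ (SimplicialComplex.isBary_bary (hx' ⟨x₀, hx₀⟩)).support_mem v₀ hv₀⟩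
  have hc : ∀ V ∈ 𝒯, ∀ V' ∈ 𝒯, c V = c V' → V = V' := by
    intro V hV V' hV' h
    simp only [c, dif_pos hV, dif_pos hV', EmbeddingLike.apply_eq_iff_eq, Subtype.mk.injEq] at h
    exact h
  let i : E → Fin 𝒯.card := fun v => c (U v)
  have hsimp : IsSimplicialMap K' (nerveImage K' i) (nerveImageMap K' i) :=
    isSimplicialMap_nerveImageMap
  refine ⟨K', 𝒯.card, nerveImage K' i, nerveImageMap K' i, hK', ?_, hsimp, ?_, ?_⟩
  · rintro t ⟨s, hs, hts⟩
    have hsne := K'.nonempty_of_mem_faces hs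
    have hcard : (0 : ℝ) < s.card := by exact_mod_cast hsne.card_pos
    -- The barycenter of `s` has positive weight at every vertex, hence lies in all the sets chosen
    -- for them.
    have hb : IsBary K'.faces (Finsupp.indicator s fun _ _ => (s.card : ℝ)⁻¹) :=
      isBary_indicator (fun t ht hne => K'.down_closed hs ht hne) (fun _ _ => by positivity)
        (by rw [Finset.sum_const, nsmul_eq_mul, mul_inv_cancel₀ hcard.ne'])
    obtain ⟨x, hx⟩ : ∃ x : K.space, (x : E) =
        weightedPoint (Finsupp.indicator s fun _ _ => (s.card : ℝ)⁻¹) :=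
      ⟨⟨_, hsp ▸ SimplicialComplex.weightedPoint_mem_space hb⟩, rfl⟩
    have hxs : ∀ v ∈ s, v ∈ (K'.bary x).support := by
      intro v hv
      rw [hx, SimplicialComplex.bary_weightedPoint hb, Finsupp.mem_support_iff,
        Finsupp.indicator_of_mem hv]
      positivity
    have hsub : (t : Set _) ⊆ (fun V => basisVector (c V)) '' {V ∈ 𝒰 | x ∈ V} := by
      rw [hts]
      rintro _ ⟨v, hv, rfl⟩
      exact ⟨U v, hsupp x v (hxs v hv), rfl⟩
    have hle := ((Set.encard_le_encard hsub).trans (Set.encard_image_le _ _)).trans (hmult x)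
    rw [Set.encard_coe_eq_coe_finsetCard] at hle
    exact_mod_cast hle
  · have himg := image_nerveImageMap (K := K') (i := i)
    rwa [hsp] at himg
  · intro p _ x hx
    obtain ⟨v, hv⟩ := (SimplicialComplex.isBary_bary (hx' x)).support_nonempty
    have hUv𝒰 := hsupp x v hv
    -- The coordinate of `p` at the basis vector of `U v` is positive, so each `y` over `p` has
    -- weight at some `u` with `U u = U v`.
    have hfib : {y : K.space | nerveImageMap K' i y = p} ⊆ U v := by
      intro y hy
      have hwx := hsimp.bary_apply (hx' x)
      have hwy := hsimp.bary_apply (hx' y)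
      rw [hx] at hwx
      rw [show nerveImageMap K' i y = p from hy] at hwy
      have hvert : ∀ (z : K.space) (u : E), u ∈ (K'.bary z).support →
          nerveImageMap K' i u = basisVector (i u) := fun z u hu =>
        nerveImageMap_vertex (SimplicialComplex.singleton_mem
          (SimplicialComplex.isBary_bary (hx' z)).support_mem hu)
      have hpos := (mapDomain_pos_iff (nerveImageMap K' i)
        (SimplicialComplex.isBary_bary (hx' x)).nonneg).2 ⟨v, hv, rfl⟩
      rw [← hwx, hwy, mapDomain_pos_iff _ (SimplicialComplex.isBary_bary (hx' y)).nonneg] at hpos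
      obtain ⟨u, hu, huv⟩ := hpos
      rw [hvert y u hu, hvert x v hv] at huv
      rw [hc _ (h𝒯 _ (SimplicialComplex.isBary_bary (hx' x)).support_mem v hv) _
        (h𝒯 _ (SimplicialComplex.isBary_bary (hx' y)).support_mem u hu)
        (basisVector_injective huv).symm]
      exact (hsupp y u hu).2
    have hFU := (connectedComponentIn_subset {y : K.space | nerveImageMap K' i y = p} x).trans hfib
    have hmem := mem_connectedComponentIn (F := {y : K.space | nerveImageMap K' i y = p}) hx
    refine hQ _ _ (Subgroup.inclusion (pi1Image_mono hFU hmem (hFU hmem)))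
      (Subgroup.inclusion_injective _) (pi1Image_fiber_fg hK'.finite hsimp hsp hx)
      ((h𝒰 _ hUv𝒰.1).2.2 ⟨x, hFU hmem⟩)

end CoverToCollapse

/-! ### From a collapse to a cover -/

section DeformationCover

variable {X : Type*} [TopologicalSpace X] {W A F : Set X}

/-- The points of `W` that a deformation of `W` moves into `F`. -/
def endsIn (H : C(I × W, X)) (F : Set X) : Set X := {x | ∃ hx : x ∈ W, H (1, ⟨x, hx⟩) ∈ F}

/-- The end map lands in `A`, so openness of `F` relative to `A` is enough. -/
theorem isOpen_endsIn (hW : IsOpen W) (H : C(I × W, X)) (h1 : ∀ x, H (1, x) ∈ A) {O : Set X}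
    (hO : IsOpen O) (hF : F = A ∩ O) : IsOpen (endsIn H F) := by
  have h : endsIn H F = Subtype.val '' {x : W | H (1, x) ∈ O} := by
    ext x
    constructor
    · rintro ⟨hx, hxF⟩
      rw [hF] at hxF
      exact ⟨⟨x, hx⟩, hxF.2, rfl⟩
    · rintro ⟨⟨x, hx⟩, hxO, rfl⟩
      exact ⟨hx, hF ▸ ⟨h1 _, hxO⟩⟩
  rw [h]
  exact hW.isOpenMap_subtype_val _ (hO.preimage (by fun_prop))

theorem deformation_mem_endsIn (H : C(I × W, X)) (hH : ∀ t x, ∃ h : H (t, x) ∈ W,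
    H (1, ⟨H (t, x), h⟩) = H (1, x)) (t : I) {x : W} (hx : H (1, x) ∈ F) :
    H (t, x) ∈ endsIn H F := by
  obtain ⟨h, he⟩ := hH t x
  exact ⟨h, he ▸ hx⟩

theorem subset_endsIn (H : C(I × W, X)) (hA : ∀ x ∈ A, ∃ h : x ∈ W, H (1, ⟨x, h⟩) = x)
    (hFA : F ⊆ A) : F ⊆ endsIn H F := by
  intro x hx
  obtain ⟨h, he⟩ := hA x (hFA hx)
  exact ⟨h, he.symm ▸ hx⟩

/-- A point is joined to `F` by its own track, which stays in the set because all points of a track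
have the same end. -/
theorem isPathConnected_endsIn (H : C(I × W, X)) (h0 : ∀ x, H (0, x) = x)
    (hH : ∀ t x, ∃ h : H (t, x) ∈ W, H (1, ⟨H (t, x), h⟩) = H (1, x))
    (hA : ∀ x ∈ A, ∃ h : x ∈ W, H (1, ⟨x, h⟩) = x) (hFA : F ⊆ A) (hF : IsPathConnected F) :
    IsPathConnected (endsIn H F) := by
  have hsub := subset_endsIn H hA hFA
  obtain ⟨y, hy⟩ := hF.nonempty
  refine ⟨y, hsub hy, fun {x} hx => ?_⟩
  obtain ⟨hxW, hxF⟩ := hx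
  refine ((hF.joinedIn y hy _ hxF).mono hsub).trans (JoinedIn.symm ⟨?_, ?_⟩)
  · exact
      { toFun := fun t => H (t, ⟨x, hxW⟩)
        continuous_toFun := by fun_prop
        source' := h0 _
        target' := rfl }
  · exact fun t => deformation_mem_endsIn H hH t hxF

theorem pi1Image_endsIn_equiv (H : C(I × W, X)) (h0 : ∀ x, H (0, x) = x)
    (hH : ∀ t x, ∃ h : H (t, x) ∈ W, H (1, ⟨H (t, x), h⟩) = H (1, x))
    (hA : ∀ x ∈ A, ∃ h : x ∈ W, H (1, ⟨x, h⟩) = x) (hFA : F ⊆ A) {x : X} (hx : x ∈ endsIn H F) :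
    Nonempty (pi1Image F ⟨H (1, ⟨x, hx.1⟩), hx.2⟩ ≃* pi1Image (endsIn H F) ⟨x, hx⟩) := by
  let H' : C(I × endsIn H F, X) := ⟨fun z => H (z.1, ⟨z.2, z.2.2.1⟩), by fun_prop⟩
  exact pi1Image_equiv_of_deformation (subset_endsIn H hA hFA) H' (fun u => h0 _) (fun u => u.2.2)
    (fun t u => deformation_mem_endsIn H hH t u.2.2) ⟨x, hx⟩

end DeformationCover

section PushWeights

variable {E F : Type*} (f : E → F) (v : F)

open Classical in
/-- The weights on the vertices that `f` sends to `v`. -/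
def fiberWeights (w : E →₀ ℝ) : E →₀ ℝ := w.filter fun u => f u = v

theorem totalMass_fiberWeights (w : E →₀ ℝ) :
    totalMass (fiberWeights f v w) = w.mapDomain f v := by
  classical
  rw [totalMass_eq_sum (s := w.support) (Finset.filter_subset _ _),
    mapDomain_apply_eq_sum f subset_rfl]
  exact Finset.sum_congr rfl fun u _ => Finsupp.filter_apply _ _ _

theorem mapDomain_fiberWeights (w : E →₀ ℝ) :
    (fiberWeights f v w).mapDomain f v = w.mapDomain f v := by
  classical
  rw [mapDomain_apply_eq_sum f (s := w.support) (Finset.filter_subset _ _),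
    mapDomain_apply_eq_sum f subset_rfl]
  refine Finset.sum_congr rfl fun u _ => ?_
  split_ifs with h
  · exact Finsupp.filter_apply_pos _ _ h
  · rfl

theorem fiberWeights_fiberWeights (w : E →₀ ℝ) :
    fiberWeights f v (fiberWeights f v w) = fiberWeights f v w := by
  classical
  ext u
  simp only [fiberWeights, Finsupp.filter_apply]
  split_ifs <;> rfl

/-- The weights `w` pushed towards the vertices that `f` sends to `v`. -/
def pushWeights (t : ℝ) (w : E →₀ ℝ) : E →₀ ℝ :=
  (1 - t) • w + (t / w.mapDomain f v) • fiberWeights f v w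

variable {f v}

theorem mapDomain_pushWeights {w : E →₀ ℝ} (hw : 0 < w.mapDomain f v) (t : ℝ) :
    (pushWeights f v t w).mapDomain f v = (1 - t) * w.mapDomain f v + t := by
  rw [pushWeights, Finsupp.mapDomain_add, Finsupp.mapDomain_smul, Finsupp.mapDomain_smul,
    Finsupp.add_apply, Finsupp.smul_apply, Finsupp.smul_apply, mapDomain_fiberWeights,
    smul_eq_mul, smul_eq_mul, div_mul_cancel₀ _ hw.ne']

/-- At time 1 the push normalizes the weights over `v` to total mass 1. A partial push only scales
these by a common factor, so their normalization is unchanged. -/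
theorem pushWeights_pushWeights {w : E →₀ ℝ} (hw : 0 < w.mapDomain f v) {t : ℝ} (ht0 : 0 ≤ t)
    (ht1 : t ≤ 1) : pushWeights f v 1 (pushWeights f v t w) = pushWeights f v 1 w := by
  have hpos : 0 < (1 - t) * w.mapDomain f v + t := by
    rcases eq_or_lt_of_le ht0 with rfl | h
    · simpa using hw
    · have := mul_nonneg (sub_nonneg.2 ht1) hw.le
      linarith
  have hfib : fiberWeights f v (pushWeights f v t w) =
      ((1 - t) + t / w.mapDomain f v) • fiberWeights f v w := by
    classical
    have hlin : fiberWeights f v (pushWeights f v t w) = (1 - t) • fiberWeights f v w +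
        (t / w.mapDomain f v) • fiberWeights f v (fiberWeights f v w) := by
      simp only [pushWeights, fiberWeights, Finsupp.filter_add, Finsupp.filter_smul]
    rw [hlin, fiberWeights_fiberWeights, add_smul]
  rw [pushWeights, mapDomain_pushWeights hw, hfib]
  simp only [pushWeights, sub_self, zero_smul, zero_add, smul_smul]
  congr 1
  field_simp

theorem isBary_pushWeights [AddCommGroup E] [Module ℝ E] {K : SimplicialComplex ℝ E} {w : E →₀ ℝ}
    (hb : IsBary K.faces w) (hw : 0 < w.mapDomain f v) {t : ℝ} (ht0 : 0 ≤ t) (ht1 : t ≤ 1) :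
    IsBary K.faces (pushWeights f v t w) := by
  classical
  have hmass : totalMass (pushWeights f v t w) = 1 := by
    rw [pushWeights, map_add, map_smul, map_smul, totalMass_fiberWeights, hb.mass, smul_eq_mul,
      smul_eq_mul, div_mul_cancel₀ _ hw.ne']
    ring
  refine ⟨fun u => ?_, K.down_closed hb.support_mem ?_ ?_, hmass⟩
  · have h1 := hb.nonneg u
    have h2 : 0 ≤ fiberWeights f v w u := by
      rw [fiberWeights, Finsupp.filter_apply]
      split_ifs
      exacts [h1, le_rfl]
    have h3 := sub_nonneg.2 ht1
    simp only [pushWeights, Finsupp.add_apply, Finsupp.smul_apply, smul_eq_mul]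
    positivity
  · exact Finsupp.support_add.trans (Finset.union_subset Finsupp.support_smul
      (Finsupp.support_smul.trans (Finset.filter_subset _ _)))
  · rw [Finsupp.support_nonempty_iff]
    intro h
    simp [h] at hmass

theorem weightedPoint_mapDomain_pushWeights_one [AddCommGroup F] [Module ℝ F] {w : E →₀ ℝ}
    (hw : 0 < w.mapDomain f v) :
    weightedPoint ((pushWeights f v 1 w).mapDomain f) = v := by
  classical
  have h : (fiberWeights f v w).mapDomain f = Finsupp.single v (w.mapDomain f v) := by
    have hcongr : (fiberWeights f v w).mapDomain f = (fiberWeights f v w).mapDomain fun _ => v :=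
      Finsupp.mapDomain_congr fun u hu => (Finset.mem_filter.1 hu).2
    have hm := totalMass_fiberWeights f v w
    rw [totalMass_eq_sum subset_rfl] at hm
    rw [hcongr, Finsupp.mapDomain, ← hm]
    exact (Finsupp.single_finsetSum _ _ _).symm
  rw [pushWeights, sub_self, zero_smul, zero_add, Finsupp.mapDomain_smul, h, Finsupp.smul_single,
    smul_eq_mul, one_div_mul_cancel hw.ne', weightedPoint_single, one_smul]

end PushWeights

section CollapseToCover

variable {E : Type u} [NormedAddCommGroup E] [NormedSpace ℝ E] {K : SimplicialComplex ℝ E}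
  {F : Type*} {f : E → F} {X : Set E}

/-- The preimage of the open star of the vertex `v`. -/
def openStarPreimage (K : SimplicialComplex ℝ E) (f : E → F) (X : Set E) (v : F) : Set X :=
  {x | 0 < (K.bary x).mapDomain f v}

theorem mapDomain_bary_eq_sum [DecidableEq F] (hK : K.faces.Finite) (v : F) {x : E}
    (hx : x ∈ K.space) : (K.bary x).mapDomain f v =
      ∑ u ∈ K.vertexFinset, if f u = v then K.bary x u else 0 :=
  mapDomain_apply_eq_sum f (SimplicialComplex.subset_vertexFinset hK
    (SimplicialComplex.isBary_bary hx).support_mem) v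

theorem continuous_mapDomain_bary (hK : K.faces.Finite) (hX : K.space = X) (v : F) :
    Continuous fun x : X => (K.bary x).mapDomain f v := by
  classical
  have h : (fun x : X => (K.bary x).mapDomain f v) = fun x : X =>
      ∑ u ∈ K.vertexFinset, if f u = v then K.bary x u else 0 :=
    funext fun x => mapDomain_bary_eq_sum hK v (hX.ge x.2)
  rw [h]
  refine continuous_finsetSum _ fun u _ => ?_
  split_ifs
  exacts [SimplicialComplex.continuous_bary_apply_of_subset hK hX.ge u, continuous_const]

theorem continuous_weightedPoint_fiberWeights (hK : K.faces.Finite) (hX : K.space = X) (v : F) :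
    Continuous fun x : X => weightedPoint (fiberWeights f v (K.bary x)) := by
  classical
  have h : (fun x : X => weightedPoint (fiberWeights f v (K.bary x))) = fun x : X =>
      ∑ u ∈ K.vertexFinset, (if f u = v then K.bary x u else 0) • u := by
    funext x
    have hsub := (Finset.filter_subset (fun u => f u = v) (K.bary x).support).trans
      (SimplicialComplex.subset_vertexFinset hK
        (SimplicialComplex.isBary_bary (hX.ge x.2)).support_mem)
    rw [weightedPoint_eq_sum (s := K.vertexFinset) (by simpa [fiberWeights] using hsub)]
    exact Finset.sum_congr rfl fun u _ => by rw [fiberWeights, Finsupp.filter_apply]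
  rw [h]
  refine continuous_finsetSum _ fun u _ => Continuous.smul ?_ continuous_const
  split_ifs
  exacts [SimplicialComplex.continuous_bary_apply_of_subset hK hX.ge u, continuous_const]

variable [NormedAddCommGroup F] [NormedSpace ℝ F] {L : SimplicialComplex ℝ F}

/-- The preimage of the open star of a vertex deforms onto the preimage of the vertex. -/
theorem exists_deformation_openStarPreimage (hK : K.faces.Finite) (hf : IsSimplicialMap K L f)
    (hX : K.space = X) {v : F} (hv : {v} ∈ L.faces) :
    ∃ H : C(I × openStarPreimage K f X v, X), (∀ x, H (0, x) = x) ∧ (∀ x, f (H (1, x)) = v) ∧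
      (∀ t x, ∃ h : H (t, x) ∈ openStarPreimage K f X v, H (1, ⟨H (t, x), h⟩) = H (1, x)) ∧
      ∀ x ∈ {x : X | f x = v}, ∃ h : x ∈ openStarPreimage K f X v, H (1, ⟨x, h⟩) = x := by
  have hb : ∀ x : X, IsBary K.faces (K.bary x) := fun x =>
    SimplicialComplex.isBary_bary (hX.ge x.2)
  have hp : ∀ x : X, weightedPoint (K.bary x) = x := fun x =>
    SimplicialComplex.weightedPoint_bary (hX.ge x.2)
  have hpb : ∀ (t : I) (x : openStarPreimage K f X v),
      IsBary K.faces (pushWeights f v t (K.bary x)) := fun t x =>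
    isBary_pushWeights (hb x) x.2 t.2.1 t.2.2
  have hcont : Continuous fun z : I × openStarPreimage K f X v =>
      weightedPoint (pushWeights f v z.1 (K.bary z.2)) := by
    have h1 : Continuous fun z : I × openStarPreimage K f X v =>
        (K.bary (z.2 : X)).mapDomain f v :=
      (continuous_mapDomain_bary hK hX v).comp (by fun_prop)
    have h2 : Continuous fun z : I × openStarPreimage K f X v =>
        weightedPoint (fiberWeights f v (K.bary (z.2 : X))) :=
      (continuous_weightedPoint_fiberWeights hK hX v).comp
        (continuous_subtype_val.comp continuous_snd)
    have h3 : Continuous fun z : I × openStarPreimage K f X v => ((z.1 : ℝ)) := by fun_prop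
    have h4 : Continuous fun z : I × openStarPreimage K f X v => ((z.2 : X) : E) := by fun_prop
    simp only [pushWeights, map_add, map_smul, hp]
    -- The denominator is the weight of the image at `v`, which is positive on the preimage of the
    -- open star.
    exact ((continuous_const.sub h3).smul h4).add ((h3.div h1 fun z => z.2.2.ne').smul h2)
  let H : C(I × openStarPreimage K f X v, X) :=
    ⟨fun z => ⟨weightedPoint (pushWeights f v z.1 (K.bary z.2)),
      hX.le (SimplicialComplex.weightedPoint_mem_space (hpb z.1 z.2))⟩, hcont.subtype_mk _⟩
  have hHb : ∀ t x, K.bary (H (t, x)) = pushWeights f v t (K.bary x) := fun t x =>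
    SimplicialComplex.bary_weightedPoint (hpb t x)
  refine ⟨H, fun x => Subtype.ext ?_, fun x => ?_, fun t x => ⟨?_, Subtype.ext ?_⟩,
    fun x hx => ⟨?_, Subtype.ext ?_⟩⟩
  · change weightedPoint (pushWeights f v (0 : I) (K.bary x)) = _
    rw [pushWeights]
    simp [hp]
  · change f (weightedPoint (pushWeights f v (1 : I) (K.bary x))) = _
    rw [hf.apply_weightedPoint (hpb 1 x)]
    exact weightedPoint_mapDomain_pushWeights_one x.2
  · change 0 < (K.bary (H (t, x))).mapDomain f v
    rw [hHb, mapDomain_pushWeights x.2]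
    have hx : 0 < (K.bary x).mapDomain f v := x.2
    have ht0 : (0 : ℝ) ≤ t := t.2.1
    rcases eq_or_lt_of_le ht0 with h | h
    · rw [← h]; simpa using hx
    · have := mul_nonneg (sub_nonneg.2 t.2.2) hx.le
      linarith
  · change weightedPoint (pushWeights f v (1 : I) (K.bary (H (t, x)))) =
      weightedPoint (pushWeights f v (1 : I) (K.bary x))
    rw [hHb]
    exact congrArg _ (pushWeights_pushWeights x.2 t.2.1 t.2.2)
  · change 0 < (K.bary x).mapDomain f v
    rw [← hf.bary_apply (hX.ge x.2), show f x = v from hx, SimplicialComplex.bary_vertex hv]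
    simp
  · classical
    have hs : (K.bary x).mapDomain f = Finsupp.single v 1 := by
      rw [← hf.bary_apply (hX.ge x.2), show f x = v from hx, SimplicialComplex.bary_vertex hv]
    have hw : fiberWeights f v (K.bary x) = K.bary x := by
      refine Finsupp.filter_eq_self_iff _ _ |>.2 fun u hu => ?_
      have := (mapDomain_pos_iff f (hb x).nonneg (v := f u)).2
        ⟨u, Finsupp.mem_support_iff.2 hu, rfl⟩
      rw [hs] at this
      by_contra hne
      rw [Finsupp.single_apply, if_neg (Ne.symm hne)] at this
      exact lt_irrefl _ this
    change weightedPoint (pushWeights f v (1 : I) (K.bary x)) = x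
    rw [pushWeights, hw, hs, Finsupp.single_eq_same]
    simp [hp]

/-- Taking components of the fibers over vertices, instead of components of star preimages, makes
the groups supplied by the collapse those of the cover. -/
theorem hasOpenCover_of_fiberCollapsing (k : ℕ)
    (Q : ∀ (G : Type u) [Group G], Prop)
    (hQ : ∀ (G H : Type u) [Group G] [Group H], G ≃* H → Q G → Q H)
    (hcol : FiberCollapsing K k Q) : HasOpenCoverOfMultiplicity K.space k Q := by
  classical
  obtain ⟨K', N, P, f, hK', hdim, hf, himg, hfib⟩ := hcol
  have hX := hK'.space_eq
  choose H h0 h1 hH hA using fun (v : EuclideanSpace ℝ (Fin N)) (hv : {v} ∈ P.faces) =>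
    exists_deformation_openStarPreimage hK'.finite hf hX hv
  have hb : ∀ x : K.space, IsBary K'.faces (K'.bary x) := fun x =>
    SimplicialComplex.isBary_bary (hX.ge x.2)
  have hsupp : ∀ (x : K.space) v, x ∈ openStarPreimage K' f K.space v ↔
      v ∈ ((K'.bary x).mapDomain f).support := fun x v => (hf.isBary (hb x)).pos_iff
  have hstar : ∀ (x : K.space) v, x ∈ openStarPreimage K' f K.space v → {v} ∈ P.faces :=
    fun x v hx => SimplicialComplex.singleton_mem (hf.isBary (hb x)).support_mem
      ((hsupp x v).1 hx)
  have hmem : ∀ v hv x, H v hv (1, x) ∈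
      connectedComponentIn {z : K.space | f z = v} (H v hv (1, x)) := fun v hv x =>
    mem_connectedComponentIn (h1 v hv x)
  refine ⟨{U | ∃ v hv, ∃ y : K.space, f y = v ∧
    U = endsIn (H v hv) (connectedComponentIn {z : K.space | f z = v} y)}, ?_, ?_, ?_⟩
  · refine Set.eq_univ_of_forall fun x => ?_
    obtain ⟨v, hv⟩ := (hf.isBary (hb x)).support_nonempty
    have hx := (hsupp x v).2 hv
    exact ⟨_, ⟨v, hstar x v hx, H v (hstar x v hx) (1, ⟨x, hx⟩), h1 _ _ _, rfl⟩, hx, hmem _ _ _⟩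
  · intro x
    let g : EuclideanSpace ℝ (Fin N) → Set K.space := fun v =>
      if hx : x ∈ openStarPreimage K' f K.space v then
        endsIn (H v (hstar x v hx)) (connectedComponentIn {z : K.space | f z = v}
          (H v (hstar x v hx) (1, ⟨x, hx⟩)))
      else ∅
    -- The deformation over `v` sends `x` to one point, hence into one component: each vertex
    -- carrying `f x` contributes one set.
    have hsub : {U | U ∈ {U | ∃ v hv, ∃ y : K.space, f y = v ∧
        U = endsIn (H v hv) (connectedComponentIn {z : K.space | f z = v} y)} ∧ x ∈ U} ⊆
        g '' (((K'.bary x).mapDomain f).support : Set _) := by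
      rintro _ ⟨⟨v, hv, y, hy, rfl⟩, hx, hxF⟩
      refine ⟨v, (hsupp x v).1 hx, ?_⟩
      simp only [g, dif_pos hx]
      rw [connectedComponentIn_eq hxF]
    refine ((Set.encard_le_encard hsub).trans (Set.encard_image_le _ _)).trans ?_
    rw [Set.encard_coe_eq_coe_finsetCard]
    exact_mod_cast hdim _ (hf.isBary (hb x)).support_mem
  · rintro _ ⟨v, hv, y, hy, rfl⟩
    obtain ⟨hpc, ⟨O, hO, hFO⟩, -⟩ := connectedComponentIn_fiber hK'.finite hf hX hy
    have hFA := connectedComponentIn_subset {z : K.space | f z = v} y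
    have hW : IsOpen (openStarPreimage K' f K.space v) :=
      isOpen_lt continuous_const (continuous_mapDomain_bary hK'.finite hX v)
    refine ⟨isOpen_endsIn hW (H v hv) (h1 v hv) hO hFO,
      isPathConnected_endsIn (H v hv) (h0 v hv) (hH v hv) (hA v hv) hFA hpc, ?_⟩
    rintro ⟨x, hx⟩
    -- The component is named by `y`, the base point of the fiber is the end of the track of `x`; a
    -- variable `C` allows rewriting one into the other inside dependent types.
    have key : ∀ C, C = connectedComponentIn {z : K.space | f z = v} (H v hv (1, ⟨x, hx.1⟩)) →
        ∀ hx' : x ∈ endsIn (H v hv) C, Q (pi1Image (endsIn (H v hv) C) ⟨x, hx'⟩) := by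
      rintro _ rfl hx'
      obtain ⟨e⟩ := pi1Image_endsIn_equiv (H v hv) (h0 v hv) (hH v hv) (hA v hv)
        (connectedComponentIn_subset _ _) hx'
      exact hQ _ _ e (hfib v (P.vertices_subset_space hv) _ (h1 v hv _))
    exact key _ (connectedComponentIn_eq hx.2) hx

end CollapseToCover

end

/-! ### The proposition -/

theorem proposition2p7 {E : Type*} [NormedAddCommGroup E] [NormedSpace ℝ E]
    (X : Geometry.SimplicialComplex ℝ E) (hfin : X.faces.Finite) (hconn : IsConnected X.space)
    (m k : ℕ) (hdim : DimEq X m) (hkm : k < m) :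
    (FiberCollapsing X k (fun G _ => HasSubexponentialGrowth G) ↔
      HasOpenCoverOfMultiplicity X.space k (fun G _ => HasSubexponentialGrowth G)) ∧
    ∀ ν : ℝ,
      (FiberCollapsing X k (fun G _ => HasSubexponentialGrowthRateLE ν G) ↔
        HasOpenCoverOfMultiplicity X.space k (fun G _ => HasSubexponentialGrowthRateLE ν G)) := by
  refine ⟨⟨hasOpenCover_of_fiberCollapsing k _ fun G H _ _ e hG => ?_,
    fiberCollapsing_of_hasOpenCover hfin hconn.nonempty k _ fun G H _ _ f hf hH hG =>
      hG.of_injective f hf hH⟩, fun ν =>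
    ⟨hasOpenCover_of_fiberCollapsing k _ fun G H _ _ e hG => ?_,
    fiberCollapsing_of_hasOpenCover hfin hconn.nonempty k _ fun G H _ _ f hf hH hG =>
      hG.of_injective f hf hH⟩⟩
  -- Invariance under isomorphism is the subgroup statement applied to the inverse.
  · have := hG.1
    exact hG.of_injective e.symm.toMonoidHom e.symm.injective
      (Group.fg_of_surjective (f := e.toMonoidHom) e.surjective)
  · have := hG.1.1
    exact hG.of_injective e.symm.toMonoidHom e.symm.injective
      (Group.fg_of_surjective (f := e.toMonoidHom) e.surjective)
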